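/- All Banach spaces are real, $\mathbb N=\{1,2,\dots\}$, and $\mathbb N^{<\mathbb N}$ is the tree of finite sequences of natural numbers ordered by end-extension $\sqsubseteq$. A *segment* is a subset $\mathfrak s$ of $\mathbb N^{<\mathbb N}$ whose elements are pairwise comparable and such that $s\sqsubseteq t\sqsubseteq s'$ with $s,s'\in\mathfrak s$ implies $t\in\mathfrak s$; two segments are *incomparable* if no node of one is comparable with a node of the other. For $1\le p\le q<\infty$ let $Z_{p,q}$ be the completion of $c_{00}(\mathbb N^{<\mathbb N})$ under the norm $$\|z\|=\sup\Big\{\Big(\sum_{i=1}^d\big(\sum_{t\in\mathfrak s_i}|z(t)|^p\big)^{q/p}\Big)^{1/q}\Big\},$$ the supremum being over all finite families $(\mathfrak s_i)_{i=1}^d$ of pairwise incomparable non-empty segments; let $z_t$ be the indicator function of the node $t$. For Banach spaces $X,Y$ let $\mathcal L(X,Y)$ be the space of bounded linear operators with the Borel $\sigma$-algebra of the strong operator topology, and $\mathcal{SS}(X,Y)$ the set of strictly singular operators, i.e. of those whose restriction to every infinite-dimensional subspace of $X$ is not an isomorphic embedding. A subset of a standard Borel space is *analytic* if it is empty or the image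 of $\mathbb N^{\mathbb N}$ under a Borel map, and *co-analytic* if its complement is analytic. A co-analytic subset $B$ of a standard Borel space $E$ is *complete* if for every co-analytic subset $C$ of a standard Borel space $W$ there is a Borel map $f:W\to E$ with $f^{-1}(B)=C$. A map $\varphi:B\to\omega_1$ is a *co-analytic rank* on $B$ if there are an analytic $R_1\subseteq E\times E$ and a co-analytic $R_2\subseteq E\times E$ such that for all $y\in B$, $x\in E$: $(x\in B$ and $\varphi(x)\le\varphi(y))\Leftrightarrow (x,y)\in R_1\Leftrightarrow (x,y)\in R_2$. The Schreier families are $\mathcal S_1=\{F\subseteq\mathbb N \text{ finite}:|F|\le\min F\}$ (with $\varnothing\in\mathcal S_1$); $\mathcal S_{\xi+1}$ consists of $\varnothing$ and the sets $F_1\cup\dots\cup F_n$ with $F_1<\dots<F_n$ non-empty members of $\mathcal S_\xi$ and $1\le n\le\min F_1$; and, for a countable limit ordinal $\xi$, with a fixed strictly increasing sequence $1\le\xi_1<\xi_2<\dots$ with supremum $\xi$, $\mathcal S_\xi$ consists of $\varnothing$ and the non-empty $F$ such that $F\in\mathcal S_{\xi_k}$ for some $k\le\min F$. An operator $T\in\mathcal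 L(X,Y)$ is *$\mathcal S_\xi$-strictly singular* if for every normalized basic sequence $(x_n)_{n\ge1}$ in $X$ and every $\varepsilon>0$ there are a non-empty $F\in\mathcal S_\xi$ and a norm-one $x\in\mathrm{span}\{x_n:n\in F\}$ with $\|T(x)\|\le\varepsilon$. Let $\varrho(T)$ be the least $1\le\xi<\omega_1$ such that $T$ is $\mathcal S_\xi$-strictly singular, and $\varrho(T)=\omega_1$ if there is none. **Theorem.** Let $1\le p<\infty$ and $Y_p=Z_{p,2p}$. Then the vectors $z_t$, $t\in\mathbb N^{<\mathbb N}$, in any enumeration, form an unconditional basis of the Banach space $Y_p$, the measurable space $\mathcal L(\ell_p,Y_p)$ is standard Borel, and the following hold. 1. $\mathcal{SS}(\ell_p,Y_p)$ is a complete co-analytic subset of $\mathcal L(\ell_p,Y_p)$; in particular it is not Borel. 2. For every choice of the sequences used to define the families $\mathcal S_\xi$ at limit ordinals, every strictly singular $T:\ell_p\to Y_p$ satisfies $\varrho(T)\le 2$, and $\varrho$ is not a co-analytic rank on $\mathcal{SS}(\ell_p,Y_p)$. -/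

import Mathlib

open scoped ENNReal Ordinal

universe u

noncomputable section

/-! ### The spaces `Z_{p,q}`

The tree `ℕ^{<ℕ}` is `List ℕ`, and `s <+: t` says that `s` is an initial segment of `t`. -/

/-- A segment of the tree: a chain which is convex for the end-extension order. -/
def IsTreeSegment (S : Set (List ℕ)) : Prop :=
  (∀ s ∈ S, ∀ t ∈ S, s <+: t ∨ t <+: s) ∧
    ∀ s t s' : List ℕ, s <+: t → t <+: s' → s ∈ S → s' ∈ S → t ∈ S

/-- Two subsets of the tree are incomparable if every node of the first one is incomparable
with every node of the second one. -/
def TreeIncomparable (A B : Set (List ℕ)) : Prop :=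
  ∀ s ∈ A, ∀ t ∈ B, ¬ s <+: t ∧ ¬ t <+: s

/-- A finite family of pairwise incomparable non-empty segments of the tree. -/
def IsIncomparableSegmentFamily {d : ℕ} (S : Fin d → Set (List ℕ)) : Prop :=
  (∀ i, (S i).Nonempty ∧ IsTreeSegment (S i)) ∧ ∀ i j, i ≠ j → TreeIncomparable (S i) (S j)

open Classical in
/-- The quantity `(∑ᵢ (∑_{t ∈ Sᵢ} |z(t)|^p)^{q/p})^{1/q}`. -/
def segmentFamilyValue (p q : ℝ) {d : ℕ} (S : Fin d → Set (List ℕ)) (z : List ℕ →₀ ℝ) : ℝ :=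
  (∑ i, (∑ t ∈ z.support with t ∈ S i, |z t| ^ p) ^ (q / p)) ^ (1 / q)

/-- The norm of `Z_{p,q}` on finitely supported functions on the tree. -/
def treeNorm (p q : ℝ) (z : List ℕ →₀ ℝ) : ℝ :=
  sSup {r | ∃ (d : ℕ) (S : Fin d → Set (List ℕ)),
    IsIncomparableSegmentFamily S ∧ r = segmentFamilyValue p q S z}

section TreeNormFacts

variable {p q : ℝ}

open Classical in
/-- The value of a family as an `ℓ_q` norm of `ℓ_p` norms. -/
theorem segment_sum_eq {d : ℕ} (S : Fin d → Set (List ℕ)) (hp : 1 ≤ p) (z : List ℕ →₀ ℝ)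
    (W : Finset (List ℕ)) (hW : z.support ⊆ W) :
    segmentFamilyValue p q S z =
      (∑ i, |(∑ t ∈ W with t ∈ S i, |z t| ^ p) ^ (1 / p)| ^ q) ^ (1 / q) := by
  unfold segmentFamilyValue
  congr 1
  refine Finset.sum_congr rfl fun i _ => ?_
  have h1 : ∑ t ∈ z.support with t ∈ S i, |z t| ^ p = ∑ t ∈ W with t ∈ S i, |z t| ^ p := by
    apply Finset.sum_subset (Finset.filter_subset_filter _ hW)
    intro t ht ht'
    have : z t = 0 := by
      by_contra h
      exact ht' (Finset.mem_filter.2 ⟨Finsupp.mem_support_iff.2 h, (Finset.mem_filter.1 ht).2⟩)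
    rw [this, abs_zero, Real.zero_rpow (by linarith)]
  have h0 : 0 ≤ ∑ t ∈ W with t ∈ S i, |z t| ^ p :=
    Finset.sum_nonneg fun t _ => Real.rpow_nonneg (abs_nonneg _) _
  rw [h1, abs_of_nonneg (Real.rpow_nonneg h0 _), ← Real.rpow_mul h0]
  congr 1
  ring

theorem segmentFamilyValue_nonneg {d : ℕ} (S : Fin d → Set (List ℕ)) (z : List ℕ →₀ ℝ) :
    0 ≤ segmentFamilyValue p q S z := by
  unfold segmentFamilyValue
  exact Real.rpow_nonneg (Finset.sum_nonneg fun i _ => Real.rpow_nonneg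
    (Finset.sum_nonneg fun t _ => Real.rpow_nonneg (abs_nonneg _) _) _) _

theorem segmentFamilyValue_add_le {d : ℕ} (S : Fin d → Set (List ℕ)) (hp : 1 ≤ p) (hq : 1 ≤ q)
    (z w : List ℕ →₀ ℝ) :
    segmentFamilyValue p q S (z + w) ≤ segmentFamilyValue p q S z + segmentFamilyValue p q S w := by
  classical
  rw [segment_sum_eq S hp (z + w) (z.support ∪ w.support) Finsupp.support_add,
    segment_sum_eq S hp z (z.support ∪ w.support) Finset.subset_union_left,
    segment_sum_eq S hp w (z.support ∪ w.support) Finset.subset_union_right]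
  refine le_trans ?_ (Real.Lp_add_le _ _ _ hq)
  have hn : ∀ (v : List ℕ →₀ ℝ) (i : Fin d),
      0 ≤ (∑ t ∈ z.support ∪ w.support with t ∈ S i, |v t| ^ p) ^ (1 / p) := fun v i =>
    Real.rpow_nonneg (Finset.sum_nonneg fun t _ => Real.rpow_nonneg (abs_nonneg _) _) _
  refine Real.rpow_le_rpow (Finset.sum_nonneg fun i _ => Real.rpow_nonneg (abs_nonneg _) _)
    (Finset.sum_le_sum fun i _ => ?_) (by positivity)
  refine Real.rpow_le_rpow (abs_nonneg _) ?_ (by linarith)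
  rw [abs_of_nonneg (hn _ i), abs_of_nonneg (add_nonneg (hn _ i) (hn _ i))]
  exact Real.Lp_add_le _ (fun t => z t) (fun t => w t) hp

theorem segmentFamilyValue_smul {d : ℕ} (S : Fin d → Set (List ℕ)) (hp : 1 ≤ p) (hq : 1 ≤ q)
    (c : ℝ) (z : List ℕ →₀ ℝ) :
    segmentFamilyValue p q S (c • z) = |c| * segmentFamilyValue p q S z := by
  classical
  rw [segment_sum_eq S hp (c • z) z.support Finsupp.support_smul,
    segment_sum_eq S hp z z.support subset_rfl]
  have key : ∀ {ι : Type} (W : Finset ι) (f : ι → ℝ) (r : ℝ), 1 ≤ r →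
      (∑ t ∈ W, |c * f t| ^ r) ^ (1 / r) = |c| * (∑ t ∈ W, |f t| ^ r) ^ (1 / r) := by
    intro ι W f r hr
    simp_rw [abs_mul, Real.mul_rpow (abs_nonneg c) (abs_nonneg _), ← Finset.mul_sum]
    rw [Real.mul_rpow (Real.rpow_nonneg (abs_nonneg c) _)
      (Finset.sum_nonneg fun t _ => Real.rpow_nonneg (abs_nonneg _) _),
      ← Real.rpow_mul (abs_nonneg c), mul_one_div_cancel (by linarith), Real.rpow_one]
  simp_rw [Finsupp.smul_apply, smul_eq_mul]
  rw [← key _ _ _ hq]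
  simp_rw [key _ _ _ hp, abs_mul, abs_abs]

theorem sum_rpow_le_sum {ι : Type*} (W : Finset ι) (f : ι → ℝ) (hf : ∀ i ∈ W, 0 ≤ f i)
    {r : ℝ} (hr : 1 ≤ r) : (∑ t ∈ W, f t ^ r) ^ (1 / r) ≤ ∑ t ∈ W, f t := by
  classical
  induction W using Finset.induction_on with
  | empty => simp [Real.zero_rpow (show r⁻¹ ≠ 0 by positivity)]
  | insert a W ha ih =>
    rw [Finset.sum_insert ha, Finset.sum_insert ha]
    have hW : ∀ i ∈ W, 0 ≤ f i := fun i hi => hf i (Finset.mem_insert_of_mem hi)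
    have h0 : 0 ≤ ∑ t ∈ W, f t ^ r := Finset.sum_nonneg fun t ht => Real.rpow_nonneg (hW t ht) _
    have ha0 : 0 ≤ f a := hf a (Finset.mem_insert_self _ _)
    have h1 : (f a ^ r + ∑ t ∈ W, f t ^ r) ^ (1 / r) ≤
        (f a ^ r) ^ (1 / r) + (∑ t ∈ W, f t ^ r) ^ (1 / r) :=
      Real.rpow_add_le_add_rpow (Real.rpow_nonneg ha0 _) h0 (by positivity)
        (by rw [div_le_one (by linarith)]; exact hr)
    rw [← Real.rpow_mul ha0, mul_one_div_cancel (by linarith), Real.rpow_one] at h1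
    linarith [ih hW]

theorem segmentFamilyValue_le {d : ℕ} {S : Fin d → Set (List ℕ)}
    (hS : IsIncomparableSegmentFamily S) (hp : 1 ≤ p) (hq : 1 ≤ q) (z : List ℕ →₀ ℝ) :
    segmentFamilyValue p q S z ≤ ∑ t ∈ z.support, |z t| := by
  classical
  rw [segment_sum_eq S hp z z.support subset_rfl]
  refine (sum_rpow_le_sum _ _ (fun i _ => abs_nonneg _) hq).trans ?_
  have h1 : ∀ i : Fin d, |(∑ t ∈ z.support with t ∈ S i, |z t| ^ p) ^ (1 / p)| ≤
      ∑ t ∈ z.support with t ∈ S i, |z t| := fun i => by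
    rw [abs_of_nonneg (Real.rpow_nonneg
      (Finset.sum_nonneg fun t _ => Real.rpow_nonneg (abs_nonneg _) _) _)]
    exact sum_rpow_le_sum _ _ (fun i _ => abs_nonneg _) hp
  refine (Finset.sum_le_sum fun i _ => h1 i).trans ?_
  rw [← Finset.sum_biUnion]
  · refine Finset.sum_le_sum_of_subset_of_nonneg ?_ fun t _ _ => abs_nonneg _
    intro t ht
    simp only [Finset.mem_biUnion, Finset.mem_filter] at ht
    obtain ⟨i, -, h, -⟩ := ht
    exact h
  · intro i _ j _ hij
    refine Finset.disjoint_left.2 fun t hi hj => ?_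
    exact (hS.2 i j hij t (Finset.mem_filter.1 hi).2 t (Finset.mem_filter.1 hj).2).1
      List.prefix_rfl

theorem treeNorm_bddAbove (hp : 1 ≤ p) (hq : 1 ≤ q) (z : List ℕ →₀ ℝ) :
    BddAbove {r | ∃ (d : ℕ) (S : Fin d → Set (List ℕ)),
      IsIncomparableSegmentFamily S ∧ r = segmentFamilyValue p q S z} := by
  refine ⟨∑ t ∈ z.support, |z t|, ?_⟩
  rintro r ⟨d, S, hS, rfl⟩
  exact segmentFamilyValue_le hS hp hq z

theorem le_treeNorm (hp : 1 ≤ p) (hq : 1 ≤ q) (z : List ℕ →₀ ℝ) {d : ℕ}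
    {S : Fin d → Set (List ℕ)} (hS : IsIncomparableSegmentFamily S) :
    segmentFamilyValue p q S z ≤ treeNorm p q z :=
  le_csSup (treeNorm_bddAbove hp hq z) ⟨d, S, hS, rfl⟩

theorem treeNorm_le {z : List ℕ →₀ ℝ} {C : ℝ}
    (h : ∀ (d : ℕ) (S : Fin d → Set (List ℕ)), IsIncomparableSegmentFamily S →
      segmentFamilyValue p q S z ≤ C) : treeNorm p q z ≤ C := by
  refine csSup_le ⟨_, 0, Fin.elim0, ⟨fun i => i.elim0, fun i => i.elim0⟩, rfl⟩ ?_
  rintro r ⟨d, S, hS, rfl⟩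
  exact h d S hS

theorem abs_apply_le_treeNorm (hp : 1 ≤ p) (hq : 1 ≤ q) (z : List ℕ →₀ ℝ) (t : List ℕ) :
    |z t| ≤ treeNorm p q z := by
  classical
  have hS : IsIncomparableSegmentFamily (fun _ : Fin 1 => ({t} : Set (List ℕ))) := by
    refine ⟨fun _ => ⟨⟨t, rfl⟩, ?_, ?_⟩, fun i j hij => absurd (Subsingleton.elim i j) hij⟩
    · rintro s rfl t' rfl
      exact Or.inl List.prefix_rfl
    · rintro s t' s' h1 h2 rfl rfl
      exact (h1.eq_of_length_le h2.length_le).symm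
  refine le_trans (le_of_eq ?_) (le_treeNorm hp hq z hS)
  rw [segment_sum_eq _ hp z (insert t z.support) (Finset.subset_insert _ _)]
  rw [Finset.univ_unique, Finset.sum_singleton, Finset.sum_filter]
  simp only [Set.mem_singleton_iff, Finset.sum_ite_eq', Finset.mem_insert_self, if_true]
  rw [← Real.rpow_mul (abs_nonneg _), mul_one_div_cancel (by linarith), Real.rpow_one,
    ← Real.rpow_mul (abs_nonneg _), mul_one_div_cancel (by linarith), Real.rpow_one, abs_abs]

theorem treeNorm_add_le (hp : 1 ≤ p) (hq : 1 ≤ q) (z w : List ℕ →₀ ℝ) :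
    treeNorm p q (z + w) ≤ treeNorm p q z + treeNorm p q w :=
  treeNorm_le fun _ S hS => (segmentFamilyValue_add_le S hp hq z w).trans
    (add_le_add (le_treeNorm hp hq z hS) (le_treeNorm hp hq w hS))

theorem treeNorm_nonneg (z : List ℕ →₀ ℝ) : 0 ≤ treeNorm p q z := by
  refine Real.sSup_nonneg ?_
  rintro r ⟨d, S, -, rfl⟩
  exact segmentFamilyValue_nonneg S z

theorem treeNorm_smul (hp : 1 ≤ p) (hq : 1 ≤ q) (c : ℝ) (z : List ℕ →₀ ℝ) :
    treeNorm p q (c • z) = |c| * treeNorm p q z := by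
  have hle : ∀ (c : ℝ) (z : List ℕ →₀ ℝ), treeNorm p q (c • z) ≤ |c| * treeNorm p q z :=
    fun c z => treeNorm_le fun _ S hS => by
      rw [segmentFamilyValue_smul S hp hq]
      exact mul_le_mul_of_nonneg_left (le_treeNorm hp hq z hS) (abs_nonneg c)
  refine le_antisymm (hle c z) ?_
  rcases eq_or_ne c 0 with rfl | hc
  · rw [abs_zero, zero_mul]
    exact treeNorm_nonneg _
  · have h := hle c⁻¹ (c • z)
    rw [smul_smul, inv_mul_cancel₀ hc, one_smul, abs_inv] at h
    rw [← div_eq_inv_mul, le_div_iff₀ (abs_pos.2 hc)] at h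
    linarith

end TreeNormFacts

/-- The vector space `c₀₀(ℕ^{<ℕ})`, to be normed by `treeNorm p q`. -/
def TreeC00 (_p _q : ℝ) : Type := List ℕ →₀ ℝ

namespace TreeC00

variable (p q : ℝ)

instance : AddCommGroup (TreeC00 p q) := inferInstanceAs (AddCommGroup (List ℕ →₀ ℝ))

instance : Module ℝ (TreeC00 p q) := inferInstanceAs (Module ℝ (List ℕ →₀ ℝ))

instance : Norm (TreeC00 p q) := ⟨fun z => treeNorm p q z⟩

/-- `c₀₀(ℕ^{<ℕ})` with the norm of `Z_{p,q}` satisfies the axioms of a normed space. -/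
theorem core [hp : Fact (1 ≤ p)] [hpq : Fact (p ≤ q)] : NormedSpace.Core ℝ (TreeC00 p q) where
  norm_nonneg z := treeNorm_nonneg (p := p) (q := q) z
  norm_smul c z := treeNorm_smul hp.out (hp.out.trans hpq.out) c z
  norm_triangle z w := treeNorm_add_le hp.out (hp.out.trans hpq.out) z w
  norm_eq_zero_iff z := by
    constructor
    · intro h
      refine Finsupp.ext (M := ℝ) fun t => ?_
      have h1 := abs_apply_le_treeNorm hp.out (hp.out.trans hpq.out) z t
      have h2 : treeNorm p q z = 0 := h
      rw [h2] at h1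
      exact abs_nonpos_iff.1 h1
    · rintro rfl
      have h := treeNorm_smul hp.out (hp.out.trans hpq.out) 0 (0 : List ℕ →₀ ℝ)
      rw [zero_smul, abs_zero, zero_mul] at h
      exact h

instance [Fact (1 ≤ p)] [Fact (p ≤ q)] : NormedAddCommGroup (TreeC00 p q) :=
  NormedAddCommGroup.ofCore (core p q)

instance [Fact (1 ≤ p)] [Fact (p ≤ q)] : NormedSpace ℝ (TreeC00 p q) :=
  NormedSpace.ofCore (core p q)

/-- The indicator function of the node `t`. -/
def single (t : List ℕ) : TreeC00 p q := (Finsupp.single t 1 : List ℕ →₀ ℝ)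

end TreeC00

/-- The Banach space `Z_{p,q}`, `1 ≤ p ≤ q < ∞`: the completion of `c₀₀(ℕ^{<ℕ})`. -/
abbrev TreeSpace (p q : ℝ) [Fact (1 ≤ p)] [Fact (p ≤ q)] : Type :=
  UniformSpace.Completion (TreeC00 p q)

/-- The vector `z_t` of `Z_{p,q}`: the indicator function of the node `t`. -/
def nodeVector (p q : ℝ) [Fact (1 ≤ p)] [Fact (p ≤ q)] (t : List ℕ) : TreeSpace p q :=
  UniformSpace.Completion.coe' (TreeC00.single p q t)

instance (p : ℝ) [hp : Fact (1 ≤ p)] : Fact (p ≤ 2 * p) := ⟨by linarith [hp.out]⟩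

instance (p : ℝ) [hp : Fact (1 ≤ p)] : Fact (1 ≤ ENNReal.ofReal p) :=
  ⟨ENNReal.one_le_ofReal.2 hp.out⟩

/-- The space `Y_p = Z_{p,2p}`. -/
abbrev YSpace (p : ℝ) [Fact (1 ≤ p)] : Type := TreeSpace p (2 * p)

/-- The real Banach space `ℓ_p`. -/
abbrev EllP (p : ℝ) [Fact (1 ≤ p)] : Type := lp (fun _ : ℕ => ℝ) (ENNReal.ofReal p)

/-! ### Descriptive set theory -/

/-- Analytic subsets of a (standard Borel) measurable space: the empty set, and the images of the
Baire space under Borel maps. -/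
def IsAnalytic {X : Type*} [MeasurableSpace X] (A : Set X) : Prop :=
  A = ∅ ∨ ∃ f : (ℕ → ℕ) → X, Measurable f ∧ Set.range f = A

/-- Co-analytic sets: complements of analytic sets. -/
def IsCoanalytic {X : Type*} [MeasurableSpace X] (A : Set X) : Prop :=
  IsAnalytic Aᶜ

/-- `B` is a complete co-analytic subset of the standard Borel space `X`: it is co-analytic, and
every co-analytic subset of a standard Borel space is the preimage of `B` under a Borel map. -/
def IsCompleteCoanalytic.{v, w} {X : Type v} [MeasurableSpace X] (B : Set X) : Prop :=
  StandardBorelSpace X ∧ IsCoanalytic B ∧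
    ∀ (W : Type w) [MeasurableSpace W] [StandardBorelSpace W] (C : Set W),
      IsCoanalytic C → ∃ f : W → X, Measurable f ∧ f ⁻¹' B = C

/-- `φ : B → ω₁` is a co-analytic rank on `B ⊆ X`: there are an analytic relation `R₁` and a
co-analytic relation `R₂` on `X` such that, for every `y ∈ B` and every `x ∈ X`,
`x ∈ B ∧ φ(x) ≤ φ(y)` iff `(x, y) ∈ R₁` iff `(x, y) ∈ R₂`. -/
def IsCoanalyticRank {X : Type*} [MeasurableSpace X] (B : Set X) (φ : B → Ordinal.{0}) : Prop :=
  (∀ x, φ x < ω₁) ∧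
    ∃ R₁ R₂ : Set (X × X), IsAnalytic R₁ ∧ IsCoanalytic R₂ ∧
      ∀ (y : B) (x : X),
        ((∃ hx : x ∈ B, φ ⟨x, hx⟩ ≤ φ y) ↔ (x, (y : X)) ∈ R₁) ∧
        ((∃ hx : x ∈ B, φ ⟨x, hx⟩ ≤ φ y) ↔ (x, (y : X)) ∈ R₂)

/-! ### Strictly singular operators

`X →Lₚₜ[ℝ] Y` is the space of bounded linear operators with the strong operator topology. -/

/-- The Borel structure of the strong operator topology. -/
instance operatorMeasurableSpace (X Y : Type*) [NormedAddCommGroup X] [NormedSpace ℝ X]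
    [NormedAddCommGroup Y] [NormedSpace ℝ Y] : MeasurableSpace (X →Lₚₜ[ℝ] Y) :=
  borel (X →Lₚₜ[ℝ] Y)

section Operators

variable {X Y : Type*} [NormedAddCommGroup X] [NormedSpace ℝ X] [NormedAddCommGroup Y]
  [NormedSpace ℝ Y]

/-- `T` is strictly singular: its restriction to any infinite-dimensional subspace is not an
isomorphic embedding, that is, not bounded below. -/
def IsStrictlySingular (T : X →Lₚₜ[ℝ] Y) : Prop :=
  ∀ Z : Submodule ℝ X, ¬ FiniteDimensional ℝ Z → ¬ ∃ c : ℝ, 0 < c ∧ ∀ z ∈ Z, c * ‖z‖ ≤ ‖T z‖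

variable (X Y) in
/-- The set of strictly singular operators from `X` to `Y`. -/
def strictlySingularOperators : Set (X →Lₚₜ[ℝ] Y) := {T | IsStrictlySingular T}

/-- `(x_n)` is a basic sequence: a Schauder basis of its closed linear span. -/
def IsBasicSequence (x : ℕ → X) : Prop :=
  ∃ b : SchauderBasis ℝ (Submodule.span ℝ (Set.range x)).topologicalClosure,
    ∀ n, (b n : X) = x n

end Operators

/-! ### Schreier families

The Schreier families at limit stages depend on the choice, for every countable limit ordinal `ξ`,
of a strictly increasing sequence of non-zero ordinals with supremum `ξ`. -/

/-- A choice of such sequences. -/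
structure LimitSequences where
  seq : Ordinal.{0} → ℕ → Ordinal.{0}
  strictMono : ∀ ξ, Order.IsSuccLimit ξ → ξ < ω₁ → StrictMono (seq ξ)
  one_le : ∀ ξ, Order.IsSuccLimit ξ → ξ < ω₁ → ∀ n, 1 ≤ seq ξ n
  isLUB : ∀ ξ, Order.IsSuccLimit ξ → ξ < ω₁ → IsLUB (Set.range (seq ξ)) ξ

/-- Such a choice exists. -/
theorem LimitSequences.nonempty : Nonempty LimitSequences := by
  have key : ∀ ξ : Ordinal.{0}, Order.IsSuccLimit ξ → ξ < ω₁ → ∃ s : ℕ → Ordinal.{0},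
      StrictMono s ∧ (∀ n, 1 ≤ s n) ∧ IsLUB (Set.range s) ξ := by
    intro ξ hξ hc
    have hcount : Countable (Set.Iio ξ) := by
      rw [Set.countable_coe_iff, ← Cardinal.le_aleph0_iff_set_countable, Cardinal.mk_Iio_ordinal]
      have : ξ.card ≤ Cardinal.aleph0 := by
        rwa [Cardinal.card_le_iff, Cardinal.succ_aleph0, Cardinal.ord_aleph]
      simpa using Cardinal.lift_le.{1}.2 this
    have h0 : (0 : Ordinal.{0}) < ξ := hξ.bot_lt
    have : Nonempty (Set.Iio ξ) := ⟨⟨0, h0⟩⟩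
    obtain ⟨e, he⟩ := exists_surjective_nat (Set.Iio ξ)
    let s : ℕ → Set.Iio ξ := fun n => Nat.rec
      ⟨Order.succ 0, hξ.succ_lt h0⟩ (fun n a => ⟨Order.succ (max a.1 (e n).1),
        hξ.succ_lt (max_lt a.2 (e n).2)⟩) n
    have hs : ∀ n, (s (n + 1)).1 = Order.succ (max (s n).1 (e n).1) := fun n => rfl
    have hmono : StrictMono fun n => (s n).1 := strictMono_nat_of_lt_succ fun n => by
      rw [hs]; exact Order.lt_succ_of_le (le_max_left _ _)
    refine ⟨fun n => (s n).1, hmono, fun n => ?_, ?_, ?_⟩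
    · refine le_trans ?_ (hmono.monotone (Nat.zero_le n))
      change 1 ≤ Order.succ (0 : Ordinal.{0})
      simp
    · rintro _ ⟨n, rfl⟩
      exact (s n).2.le
    · intro b hb
      by_contra hlt
      obtain ⟨n, hn⟩ := he ⟨b, not_le.1 hlt⟩
      have h1 := hb ⟨n + 1, rfl⟩
      change (s (n+1)).1 ≤ b at h1
      rw [hs, hn, Order.succ_le_iff] at h1
      exact absurd (lt_of_le_of_lt (le_max_right _ _) h1) (lt_irrefl _)
  choose! s h1 h2 h3 using key
  exact ⟨⟨s, h1, h2, h3⟩⟩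

/-- The Schreier families `S_ξ`, as families of finite sets of natural numbers (for `ξ ≥ 1` all
their members are contained in `{1, 2, …}`).
* `S_0` consists of the sets with at most one element;
* `S_{ξ+1}` consists of the unions `F_1 ∪ … ∪ F_n` with `F_1 < … < F_n` non-empty members of `S_ξ`
  and `n ≤ min F_1` (`n = 0` gives the empty set); in particular
  `S_1 = {F : |F| ≤ min F}`;
* for limit `ξ` with chosen sequence `ξ_1 < ξ_2 < …`, `S_ξ` consists of those `F` that lie in
  `S_{ξ_k}` for some `k ≥ 1` with `k ≤ min F`; here `ξ_{n+1}` is `c.seq ξ n`. -/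
def schreier (c : LimitSequences) (ξ : Ordinal.{0}) : Set (Finset ℕ) :=
  Ordinal.limitRecOn (motive := fun _ => Set (Finset ℕ)) ξ
    {F | F.card ≤ 1}
    (fun _ 𝓕 => {F | ∃ (n : ℕ) (G : Fin n → Finset ℕ),
      (∀ i, G i ∈ 𝓕 ∧ (G i).Nonempty) ∧
      (∀ i j, i < j → ∀ a ∈ G i, ∀ b ∈ G j, a < b) ∧
      (∀ a ∈ F, n ≤ a) ∧ F = Finset.univ.biUnion G})
    (fun ξ _ 𝓕 => {F | ∃ (n : ℕ) (h : c.seq ξ n < ξ),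
      F ∈ 𝓕 (c.seq ξ n) h ∧ ∀ a ∈ F, n + 1 ≤ a})

section Rho

variable {X Y : Type*} [NormedAddCommGroup X] [NormedSpace ℝ X] [NormedAddCommGroup Y]
  [NormedSpace ℝ Y]

/-- `T` is `S_ξ`-strictly singular. Sequences `x : ℕ → X` start at `0` while the members of
`S_ξ` are subsets of `{1, 2, …}`, so that `x k` is the vector with number `k + 1`. -/
def IsSchreierStrictlySingular (c : LimitSequences) (ξ : Ordinal.{0}) (T : X →Lₚₜ[ℝ] Y) : Prop :=
  ∀ x : ℕ → X, IsBasicSequence x → (∀ n, ‖x n‖ = 1) → ∀ ε : ℝ, 0 < ε →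
    ∃ F ∈ schreier c ξ, F.Nonempty ∧
      ∃ v ∈ Submodule.span ℝ (x '' {k | k + 1 ∈ F}), ‖v‖ = 1 ∧ ‖T v‖ ≤ ε

/-- The rank `ϱ(T)`: the least `1 ≤ ξ < ω₁` such that `T` is `S_ξ`-strictly singular, and `ω₁` if
there is no such `ξ`. -/
def rho (c : LimitSequences) (T : X →Lₚₜ[ℝ] Y) : Ordinal.{0} :=
  sInf (insert ω₁ {ξ | 1 ≤ ξ ∧ ξ < ω₁ ∧ IsSchreierStrictlySingular c ξ T})

end Rho

end

/-! Put `f = |z|^p`. Because `q = 2p`, the norm of `Y_p` to the power `2p` is the supremum of the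
sums of squared masses of `f` over incomparable segments (`SquareMassLE`). A branch is a single
segment, so the norm of `Y_p` restricted to it is an `ℓ_p` norm, and strict singularity of `T : ℓ_p
→ Y_p` is decided on branches. Let `(u_k)` be a bounded seminormalized sequence such that `u_k` and
`T u_k` are coordinatewise null. If `T u_k` does not tend to zero on some branch, a gliding hump
gives a subsequence equivalent to the unit vectors of `ℓ_p` on which `T` is bounded below
(`not_isStrictlySingular_of_branch`). If `T u_k` tends to zero on every branch, there are
combinations supported on sets of `S_2` whose images are relatively small
(`exists_small_combination`).

The second alternative is the combinatorial core. A square-mass bound `C` leaves room for at most `C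
/ η^2` incomparable pieces of mass `η`. With an ultrafilter this shows that if almost all pairs
`f_j, f_k` were heavy on a common path, then one branch would be heavy for infinitely many `f_j`.
Hence some infinite subfamily has no two members heavy on a common path, and its Schreier averages
are small on all paths (`exists_averageOn_pathMass_le`). Averaging such averages, each chosen after
the earlier ones, makes the cross terms of the square small and divides the diagonal by `n`
(`exists_average_squareMassLE`). Two levels of averaging mean `S_2`, whence `ϱ(T) ≤ 2`.

For completeness, a tree `S` is sent to the operator which maps `e_t` to `z_t` for `t` in `S` and to
zero otherwise. A branch through `S` gives a copy of `ℓ_p` on which the operator is bounded below,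
and a well-founded `S` gives a strictly singular operator. Every analytic set consists of the points
at which a Borel family of trees has a branch, so every co-analytic set reduces to the strictly
singular operators. These are co-analytic, since failure of strict singularity is witnessed by one
sequence satisfying countably many inequalities.

Finally, a rank with values at most 2 attains its maximum. If it were a co-analytic rank, a section
of the analytic relation `R₁` would be the whole set; this set would be analytic and co-analytic,
hence Borel by Suslin's theorem, which it is not. -/

noncomputable section

open MeasureTheory Set Filter Topology

/-! ### Branches of the tree -/

/-- The node of length `n` on the branch `σ`. -/
def branchNode (σ : ℕ → ℕ) (n : ℕ) : List ℕ := (List.range n).map σ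

@[simp] theorem branchNode_length (σ : ℕ → ℕ) (n : ℕ) : (branchNode σ n).length = n := by
  simp [branchNode]

theorem branchNode_prefix (σ : ℕ → ℕ) {m n : ℕ} (h : m ≤ n) :
    branchNode σ m <+: branchNode σ n := by
  obtain ⟨k, rfl⟩ := Nat.exists_eq_add_of_le h
  exact ⟨(List.range k).map (fun i => σ (m + i)), by
    simp [branchNode, List.range_add, List.map_map, Function.comp_def]⟩

theorem branchNode_injective (σ : ℕ → ℕ) : Function.Injective (branchNode σ) := fun m n h => by
  simpa using congrArg List.length h

theorem prefix_branchNode_iff {σ : ℕ → ℕ} {n : ℕ} {s : List ℕ} :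
    s <+: branchNode σ n ↔ s.length ≤ n ∧ s = branchNode σ s.length := by
  constructor
  · intro h
    have hl : s.length ≤ n := by simpa using h.length_le
    refine ⟨hl, ?_⟩
    have h2 := List.prefix_of_prefix_length_le h (branchNode_prefix σ hl) (by simp)
    exact h2.eq_of_length (by simp)
  · rintro ⟨hl, hs⟩
    rw [hs]
    exact branchNode_prefix σ hl

theorem branchNode_eq_iff {σ τ : ℕ → ℕ} {n : ℕ} :
    branchNode τ n = branchNode σ n ↔ τ ∈ PiNat.cylinder σ n := by
  simp [branchNode, PiNat.cylinder]

/-- A family of pairwise comparable nodes of unbounded length lies on a branch. -/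
theorem exists_branch_of_chain {S : Set (List ℕ)}
    (hc : ∀ s ∈ S, ∀ t ∈ S, s <+: t ∨ t <+: s) (hinf : ∀ n : ℕ, ∃ s ∈ S, n ≤ s.length) :
    ∃ σ : ℕ → ℕ, ∀ s ∈ S, s = branchNode σ s.length := by
  -- The `n`-th entry of the branch is read off some member of `S` longer than `n`; comparability
  -- makes the choice irrelevant.
  choose f hfS hf using fun n => hinf (n + 1)
  refine ⟨fun n => (f n)[n]'(hf n), fun s hs => ?_⟩
  refine List.ext_getElem (by simp) fun i h1 h2 => ?_
  simp only [branchNode, List.getElem_map, List.getElem_range]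
  rcases hc s hs (f i) (hfS i) with h | h
  · exact h.getElem h1
  · exact (h.getElem (hf i)).symm

/-! ### Analytic sets -/

/-- The two notions differ only in asking for Borel or continuous parametrizations, and Borel images
of Borel sets in Polish spaces are analytic in the continuous sense. -/
theorem isAnalytic_iff_analyticSet {X : Type*} [TopologicalSpace X] [PolishSpace X]
    [MeasurableSpace X] [BorelSpace X] {A : Set X} : IsAnalytic A ↔ AnalyticSet A := by
  constructor
  · rintro (rfl | ⟨f, hf, rfl⟩)
    · exact analyticSet_empty
    · rw [← image_univ]
      exact MeasurableSet.univ.analyticSet_image hf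
  · intro h
    rw [AnalyticSet] at h
    exact h.imp id fun ⟨f, hf, hr⟩ => ⟨f, hf.measurable, hr⟩

theorem isAnalytic_image {X Y : Type*} [MeasurableSpace X] [StandardBorelSpace X]
    [MeasurableSpace Y] [StandardBorelSpace Y] {f : X → Y} (hf : Measurable f) {s : Set X}
    (hs : MeasurableSet s) : IsAnalytic (f '' s) := by
  let := upgradeStandardBorel Y
  exact isAnalytic_iff_analyticSet.2 (hs.analyticSet_image hf)

theorem isAnalytic_of_measurableSet {X : Type*} [MeasurableSpace X] [StandardBorelSpace X]
    {s : Set X} (hs : MeasurableSet s) : IsAnalytic s := by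
  simpa using isAnalytic_image measurable_id hs

/-- Suslin's theorem. -/
theorem measurableSet_of_isAnalytic_compl {X : Type*} [MeasurableSpace X] [StandardBorelSpace X]
    {s : Set X} (hs : IsAnalytic s) (hs' : IsAnalytic sᶜ) : MeasurableSet s := by
  let := upgradeStandardBorel X
  exact (isAnalytic_iff_analyticSet.1 hs).measurableSet_of_compl (isAnalytic_iff_analyticSet.1 hs')

/-- If `f` parametrizes `R`, its first coordinate maps the Borel set of parameters whose second
coordinate is `y` onto the section. -/
theorem IsAnalytic.section_right {X : Type*} [MeasurableSpace X] [StandardBorelSpace X]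
    {R : Set (X × X)} (hR : IsAnalytic R) (y : X) : IsAnalytic {x | (x, y) ∈ R} := by
  rcases hR with rfl | ⟨f, hf, rfl⟩
  · exact Or.inl (by simp)
  · have h : MeasurableSet {b : ℕ → ℕ | (f b).2 = y} := hf.snd (measurableSet_singleton y)
    convert isAnalytic_image hf.fst h using 1
    ext x
    simp only [mem_range, mem_ofPred_eq, mem_image, Prod.ext_iff]
    exact exists_congr fun b => and_comm

/-- There is an analytic subset of the Baire space which is not Borel. -/
theorem exists_isAnalytic_not_measurableSet :
    ∃ A : Set (ℕ → ℕ), IsAnalytic A ∧ ¬ MeasurableSet A := by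
  obtain ⟨B, hBc, -, hB⟩ := TopologicalSpace.exists_countable_basis ((ℕ → ℕ) × (ℕ → ℕ))
  have hBne : B.Nonempty := by
    by_contra h
    rw [not_nonempty_iff_eq_empty] at h
    obtain ⟨u, hu, -⟩ := hB.exists_subset_of_mem_open (mem_univ ((0 : ℕ → ℕ), (0 : ℕ → ℕ)))
      isOpen_univ
    simp [h] at hu
  obtain ⟨b, rfl⟩ := hBc.exists_eq_range hBne
  have hbo : ∀ n, IsOpen (b n) := fun n => hB.isOpen ⟨n, rfl⟩
  -- A universal closed set read along the diagonal: the zeros of the first coordinate list the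
  -- basic open sets to be removed.
  let F : Set ((ℕ → ℕ) × (ℕ → ℕ)) := {z | ∀ n, z.1 n = 0 → (z.1, z.2) ∉ b n}
  have hF : MeasurableSet F := by
    have : F = ⋂ n, ({z | z.1 n = 0} ∩ b n)ᶜ := by
      ext z; simp [F]
    rw [this]
    refine MeasurableSet.iInter fun n => (MeasurableSet.inter ?_ (hbo n).measurableSet).compl
    exact (measurable_pi_apply n).comp measurable_fst (measurableSet_singleton 0)
  refine ⟨Prod.fst '' F, isAnalytic_image measurable_fst hF, fun hm => ?_⟩
  have hc := isAnalytic_iff_analyticSet.1 (isAnalytic_of_measurableSet hm.compl)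
  rw [AnalyticSet] at hc
  -- A continuous image of the Baire space is the projection of a closed graph.
  obtain ⟨G, hG, hGA⟩ : ∃ G : Set ((ℕ → ℕ) × (ℕ → ℕ)), IsClosed G ∧
      Prod.fst '' G = (Prod.fst '' F)ᶜ := by
    rcases hc with h | ⟨f, hf, hr⟩
    · exact ⟨∅, isClosed_empty, by rw [h, image_empty]⟩
    · refine ⟨{z | f z.2 = z.1}, isClosed_eq (hf.comp continuous_snd) continuous_fst, ?_⟩
      rw [← hr]
      ext x
      simp
  classical
  -- `c` codes the complement of `G`, so `F` and `G` have the same section at `c`, although their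
  -- projections are complementary.
  let c : ℕ → ℕ := fun n => if Disjoint (b n) G then 0 else 1
  have hcG : ∀ y, (c, y) ∈ G ↔ (c, y) ∈ F := by
    intro y
    constructor
    · intro h n hn hb
      have : Disjoint (b n) G := by
        by_contra h'
        simp [c, h'] at hn
      exact this.le_bot ⟨hb, h⟩
    · intro h
      by_contra hy
      obtain ⟨u, ⟨n, rfl⟩, hu, hsub⟩ := hB.exists_subset_of_mem_open hy hG.isOpen_compl
      refine h n ?_ hu
      have : Disjoint (b n) G := disjoint_left.2 fun z hz hz' => hsub hz hz'
      simp [c, this]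
  have h1 : c ∈ Prod.fst '' F ↔ c ∈ Prod.fst '' G := by
    simp only [mem_image, Prod.exists, exists_and_right, exists_eq_right, hcG]
  rw [hGA] at h1
  exact (iff_not_self h1).elim

/-- Every analytic set is the set of points at which a measurable family of trees has a branch. -/
theorem IsAnalytic.exists_tree {W : Type*} [MeasurableSpace W] [StandardBorelSpace W] {A : Set W}
    (hA : IsAnalytic A) : ∃ 𝒯 : W → Set (List ℕ), (∀ t, MeasurableSet {w | t ∈ 𝒯 w}) ∧
      (∀ w s t, s <+: t → t ∈ 𝒯 w → s ∈ 𝒯 w) ∧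
      ∀ w, w ∈ A ↔ ∃ σ : ℕ → ℕ, ∀ n, branchNode σ n ∈ 𝒯 w := by
  let := upgradeStandardBorel W
  rw [isAnalytic_iff_analyticSet, AnalyticSet] at hA
  rcases hA with rfl | ⟨g, hg, rfl⟩
  · exact ⟨fun _ => ∅, by simp, by simp, by simp⟩
  -- Taking the closure makes membership of a node a closed condition on `w`; continuity of `g`
  -- still forces `w = g σ` along a branch `σ`.
  refine ⟨fun w => {t | w ∈ closure (g '' {τ | branchNode τ t.length = t})},
    fun t => isClosed_closure.measurableSet, ?_, fun w => ⟨?_, ?_⟩⟩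
  · intro w s t hst ht
    refine closure_mono (image_mono ?_) ht
    intro τ hτ
    simp only [mem_ofPred_eq] at hτ ⊢
    rw [← hτ] at hst
    exact (prefix_branchNode_iff.1 hst).2.symm
  · rintro ⟨σ, rfl⟩
    exact ⟨σ, fun n => subset_closure ⟨σ, by simp, rfl⟩⟩
  · rintro ⟨σ, hσ⟩
    refine ⟨σ, ?_⟩
    by_contra hne
    obtain ⟨U, ⟨hU, hUc⟩, hUw⟩ := (closed_nhds_basis (g σ)).mem_iff.1
      (isOpen_compl_singleton.mem_nhds hne : ({w}ᶜ : Set W) ∈ 𝓝 (g σ))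
    obtain ⟨_, ⟨τ, n, rfl⟩, hτ, hsub⟩ := (PiNat.isTopologicalBasis_cylinders
      (fun _ : ℕ => ℕ)).mem_nhds_iff.1 (hg.continuousAt.preimage_mem_nhds hU)
    refine hUw (closure_minimal ?_ hUc (hσ n)) rfl
    rintro _ ⟨ρ, hρ, rfl⟩
    simp only [branchNode_length, mem_ofPred_eq, branchNode_eq_iff] at hρ
    refine hsub ?_
    rw [PiNat.mem_cylinder_iff_eq] at hρ hτ
    rw [PiNat.mem_cylinder_iff_eq, hρ, hτ]

/-! ### Masses of finitely supported functions on the tree -/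

/-- The sum of the values of `f` on the set `S`. -/
def massOn (S : Set (List ℕ)) : (List ℕ →₀ ℝ) →ₗ[ℝ] ℝ :=
  Finsupp.linearCombination ℝ (S.indicator 1)

open Classical in
theorem massOn_eq_sum_filter (S : Set (List ℕ)) (f : List ℕ →₀ ℝ) {W : Finset (List ℕ)}
    (hW : f.support ⊆ W) : massOn S f = ∑ t ∈ W with t ∈ S, f t := by
  rw [massOn, Finsupp.linearCombination_apply, Finsupp.sum_of_support_subset _ hW _ (by simp),
    Finset.sum_filter]
  refine Finset.sum_congr rfl fun t _ => ?_
  by_cases h : t ∈ S <;> simp [h]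

theorem massOn_coe_finset (S : Finset (List ℕ)) (f : List ℕ →₀ ℝ) :
    massOn S f = ∑ t ∈ S, f t := by
  classical
  rw [massOn_eq_sum_filter _ f (Finset.subset_union_left (s₂ := S))]
  refine Finset.sum_congr (by ext; simp) fun _ _ => rfl

theorem massOn_nonneg (S : Set (List ℕ)) {f : List ℕ →₀ ℝ} (hf : ∀ t, 0 ≤ f t) :
    0 ≤ massOn S f := by
  classical
  rw [massOn_eq_sum_filter S f subset_rfl]
  exact Finset.sum_nonneg fun t _ => hf t

theorem massOn_le_massOn {S T : Set (List ℕ)} {f : List ℕ →₀ ℝ} (hf : ∀ t, 0 ≤ f t)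
    (h : ∀ t ∈ f.support, t ∈ S → t ∈ T) : massOn S f ≤ massOn T f := by
  classical
  rw [massOn_eq_sum_filter S f subset_rfl, massOn_eq_sum_filter T f subset_rfl]
  refine Finset.sum_le_sum_of_subset_of_nonneg ?_ fun t _ _ => hf t
  intro t ht
  rw [Finset.mem_filter] at ht ⊢
  exact ⟨ht.1, h t ht.1 ht.2⟩

/-- The sum of the values of `f` on the nodes of length less than `n` of the branch `σ`. -/
def pathMass (f : List ℕ →₀ ℝ) (σ : ℕ → ℕ) (n : ℕ) : ℝ :=
  ∑ i ∈ Finset.range n, f (branchNode σ i)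

theorem massOn_image_branchNode (f : List ℕ →₀ ℝ) (σ : ℕ → ℕ) (I : Finset ℕ) :
    massOn (branchNode σ '' I) f = ∑ i ∈ I, f (branchNode σ i) := by
  classical
  rw [← Finset.coe_image, massOn_coe_finset,
    Finset.sum_image fun _ _ _ _ h => branchNode_injective σ h]

theorem pathMass_eq_massOn (f : List ℕ →₀ ℝ) (σ : ℕ → ℕ) (n : ℕ) :
    pathMass f σ n = massOn (branchNode σ '' Finset.range n) f :=
  (massOn_image_branchNode f σ _).symm

theorem pathMass_nonneg {f : List ℕ →₀ ℝ} (hf : ∀ t, 0 ≤ f t) (σ : ℕ → ℕ) (n : ℕ) :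
    0 ≤ pathMass f σ n :=
  Finset.sum_nonneg fun _ _ => hf _

theorem exists_branchNode_eq (t : List ℕ) : ∃ σ : ℕ → ℕ, branchNode σ t.length = t := by
  refine ⟨fun i => t.getD i 0, List.ext_getElem (by simp) fun i h1 h2 => ?_⟩
  simp [branchNode, h2]

/-- The mass on a segment is at most the mass on some initial part of a branch. -/
theorem IsTreeSegment.exists_massOn_le_pathMass {S : Set (List ℕ)} (hS : IsTreeSegment S)
    {f : List ℕ →₀ ℝ} (hf : ∀ t, 0 ≤ f t) : ∃ σ n, massOn S f ≤ pathMass f σ n := by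
  classical
  rcases (f.support.filter (· ∈ S)).eq_empty_or_nonempty with h | h
  · refine ⟨0, 0, ?_⟩
    rw [massOn_eq_sum_filter S f subset_rfl, h]
    simp [pathMass]
  -- All support nodes in the segment are initial segments of the longest one, `t`. Path masses
  -- count lengths below `n`, hence `t.length + 1`.
  · obtain ⟨t, ht, hmax⟩ := Finset.exists_max_image _ List.length h
    obtain ⟨σ, hσ⟩ := exists_branchNode_eq t
    refine ⟨σ, t.length + 1, ?_⟩
    rw [pathMass_eq_massOn]
    refine massOn_le_massOn hf fun s hs hsS => ?_
    have hst : s <+: t := by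
      rcases hS.1 s hsS t (Finset.mem_filter.1 ht).2 with h1 | h1
      · exact h1
      · rw [h1.eq_of_length_le (hmax s (Finset.mem_filter.2 ⟨hs, hsS⟩))]
    rw [← hσ] at hst
    obtain ⟨h1, h2⟩ := prefix_branchNode_iff.1 hst
    exact ⟨s.length, by simpa using Nat.lt_succ_of_le h1, h2.symm⟩

theorem isTreeSegment_image_Ico (σ : ℕ → ℕ) (a b : ℕ) :
    IsTreeSegment (branchNode σ '' Finset.Ico a b) := by
  refine ⟨?_, ?_⟩
  · rintro _ ⟨i, -, rfl⟩ _ ⟨j, -, rfl⟩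
    exact (le_total i j).imp (branchNode_prefix σ) (branchNode_prefix σ)
  · rintro _ t _ h1 h2 ⟨i, hi, rfl⟩ ⟨j, hj, rfl⟩
    obtain ⟨h3, h4⟩ := prefix_branchNode_iff.1 h2
    refine ⟨t.length, ?_, h4.symm⟩
    have := h1.length_le
    simp at hi hj this ⊢
    omega

theorem isIncomparableSegmentFamily_const {S : Set (List ℕ)} (hS : IsTreeSegment S)
    (hne : S.Nonempty) : IsIncomparableSegmentFamily fun _ : Fin 1 => S :=
  ⟨fun _ => ⟨hne, hS⟩, fun i j hij => absurd (Subsingleton.elim i j) hij⟩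

/-- The total mass on the members of an incomparable family is at most the full mass. -/
theorem IsIncomparableSegmentFamily.sum_massOn_le {d : ℕ} {S : Fin d → Set (List ℕ)}
    (hS : IsIncomparableSegmentFamily S) {f : List ℕ →₀ ℝ} (hf : ∀ t, 0 ≤ f t) :
    ∑ i, massOn (S i) f ≤ massOn univ f := by
  classical
  simp_rw [massOn_eq_sum_filter _ f subset_rfl]
  rw [← Finset.sum_biUnion]
  · refine Finset.sum_le_sum_of_subset_of_nonneg ?_ fun t _ _ => hf t
    intro t ht
    simp only [Finset.mem_biUnion, Finset.mem_filter] at ht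
    obtain ⟨i, -, h, -⟩ := ht
    simpa using h
  · intro i _ j _ hij
    refine Finset.disjoint_left.2 fun t hi hj => ?_
    exact (hS.2 i j hij t (Finset.mem_filter.1 hi).2 t (Finset.mem_filter.1 hj).2).1
      List.prefix_rfl

/-- `C` bounds the sums of the squares of the masses of `f` on incomparable segments. -/
def SquareMassLE (f : List ℕ →₀ ℝ) (C : ℝ) : Prop :=
  ∀ (d : ℕ) (S : Fin d → Set (List ℕ)), IsIncomparableSegmentFamily S →
    ∑ i, massOn (S i) f ^ 2 ≤ C

theorem SquareMassLE.nonneg {f : List ℕ →₀ ℝ} {C : ℝ} (h : SquareMassLE f C) : 0 ≤ C := by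
  simpa using h 0 Fin.elim0 ⟨fun i => i.elim0, fun i => i.elim0⟩

theorem SquareMassLE.pathMass_le {f : List ℕ →₀ ℝ} {C : ℝ} (h : SquareMassLE f C)
    (σ : ℕ → ℕ) (n : ℕ) : pathMass f σ n ≤ √C := by
  rcases Nat.eq_zero_or_pos n with rfl | hn
  · simp [pathMass]
  · refine Real.le_sqrt_of_sq_le ?_
    have := h 1 _ (isIncomparableSegmentFamily_const (isTreeSegment_image_Ico σ 0 n)
      ⟨_, 0, by simpa using hn, rfl⟩)
    simpa [pathMass_eq_massOn, Nat.Ico_zero_eq_range] using this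

/-- A bounded number of nodes witnesses all paths on which the mass of `f` is large. -/
theorem SquareMassLE.exists_cover {f : List ℕ →₀ ℝ} {C η : ℝ} (h : SquareMassLE f C)
    (hη : 0 < η) : ∃ d : Fin ⌊C / η ^ 2⌋₊ → List ℕ, ∀ σ n, η ≤ pathMass f σ n →
      ∃ m, ∃ i < n, branchNode σ i ∈ f.support ∧ branchNode σ i <+: d m := by
  classical
  -- `D` collects the support nodes at which a piece of a branch of mass at least `η` starts, and
  -- `L` the maximal nodes of `D`. Pieces starting at distinct maximal nodes are incomparable, so
  -- `L.card * η ^ 2 ≤ C`.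
  let D : Finset (List ℕ) := f.support.filter fun t => ∃ σ a b, t = branchNode σ a ∧
    η ≤ ∑ i ∈ Finset.Ico a b, f (branchNode σ i)
  let L : Finset (List ℕ) := D.filter fun t => ∀ s ∈ D, t <+: s → s = t
  have hcard : L.card ≤ ⌊C / η ^ 2⌋₊ := by
    refine Nat.le_floor ?_
    rw [le_div_iff₀ (by positivity)]
    have hL : ∀ t : L, ∃ σ a b, (t : List ℕ) = branchNode σ a ∧
        η ≤ ∑ i ∈ Finset.Ico a b, f (branchNode σ i) := fun t =>
      (Finset.mem_filter.1 (Finset.mem_filter.1 t.2).1).2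
    choose σ a b hta hη' using hL
    let e := L.equivFin
    have hpre : ∀ (t : L), ∀ s ∈ branchNode (σ t) '' Finset.Ico (a t) (b t), (t : List ℕ) <+: s := by
      rintro t _ ⟨i, hi, rfl⟩
      rw [hta t]
      exact branchNode_prefix _ (Finset.mem_Ico.1 hi).1
    have hleaf : ∀ t t' : L, ∀ s, (t : List ℕ) <+: s → (t' : List ℕ) <+: s → t = t' := by
      intro t t' s h1 h2
      rcases List.prefix_or_prefix_of_prefix h1 h2 with h3 | h3
      · exact Subtype.ext ((Finset.mem_filter.1 t.2).2 _ (Finset.mem_filter.1 t'.2).1 h3).symm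
      · exact Subtype.ext ((Finset.mem_filter.1 t'.2).2 _ (Finset.mem_filter.1 t.2).1 h3)
    have hfam : IsIncomparableSegmentFamily fun i : Fin L.card =>
        branchNode (σ (e.symm i)) '' Finset.Ico (a (e.symm i)) (b (e.symm i)) := by
      refine ⟨fun i => ⟨?_, isTreeSegment_image_Ico _ _ _⟩, fun i j hij s hs s' hs' => ?_⟩
      · rw [image_nonempty]
        by_contra hne
        rw [Finset.coe_nonempty, Finset.not_nonempty_iff_eq_empty] at hne
        have := hη' (e.symm i)
        rw [hne, Finset.sum_empty] at this
        linarith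
      · have hij' : e.symm i ≠ e.symm j := fun h => hij (e.symm.injective h)
        exact ⟨fun h => hij' (hleaf _ _ _ ((hpre _ _ hs).trans h) (hpre _ _ hs')),
          fun h => hij' (hleaf _ _ _ (hpre _ _ hs) ((hpre _ _ hs').trans h))⟩
    have hsum := h _ _ hfam
    refine le_trans ?_ hsum
    have : ∀ i : Fin L.card, η ^ 2 ≤
        massOn (branchNode (σ (e.symm i)) '' Finset.Ico (a (e.symm i)) (b (e.symm i))) f ^ 2 := by
      intro i
      rw [massOn_image_branchNode]
      exact pow_le_pow_left₀ hη.le (hη' _) 2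
    calc (L.card : ℝ) * η ^ 2 = ∑ _i : Fin L.card, η ^ 2 := by simp
      _ ≤ _ := Finset.sum_le_sum fun i _ => this i
  -- Surplus indices receive the root. A heavy path carries no mass before its first support node,
  -- so that node lies in `D` and has an extension in `L`.
  refine ⟨fun m => L.toList.getD m [], fun σ n hn => ?_⟩
  have hex : ∃ i, i < n ∧ f (branchNode σ i) ≠ 0 := by
    by_contra hne
    push Not at hne
    have : pathMass f σ n = 0 := Finset.sum_eq_zero fun i hi => hne i (Finset.mem_range.1 hi)
    linarith
  let a := Nat.find hex
  obtain ⟨ha, ha0⟩ : a < n ∧ f (branchNode σ a) ≠ 0 := Nat.find_spec hex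
  have hsum : ∑ i ∈ Finset.Ico a n, f (branchNode σ i) = pathMass f σ n := by
    rw [pathMass, ← Finset.sum_range_add_sum_Ico _ ha.le, right_eq_add]
    refine Finset.sum_eq_zero fun i hi => ?_
    by_contra h0
    exact Nat.find_min hex (Finset.mem_range.1 hi) ⟨(Finset.mem_range.1 hi).trans ha, h0⟩
  have haD : branchNode σ a ∈ D := Finset.mem_filter.2
    ⟨Finsupp.mem_support_iff.2 ha0, σ, a, n, rfl, hsum.symm ▸ hn⟩
  obtain ⟨s, hs, hmax⟩ := Finset.exists_max_image (D.filter (branchNode σ a <+: ·)) List.length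
    ⟨_, Finset.mem_filter.2 ⟨haD, List.prefix_rfl⟩⟩
  obtain ⟨hsD, has⟩ := Finset.mem_filter.1 hs
  have hsL : s ∈ L := Finset.mem_filter.2 ⟨hsD, fun s' hs' hss' =>
    (hss'.eq_of_length_le (hmax s' (Finset.mem_filter.2 ⟨hs', has.trans hss'⟩))).symm⟩
  obtain ⟨m, hm, hms⟩ := List.getElem_of_mem (Finset.mem_toList.2 hsL)
  refine ⟨⟨m, ?_⟩, a, ha, Finsupp.mem_support_iff.2 ha0, ?_⟩
  · rw [Finset.length_toList] at hm
    omega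
  · simpa [List.getElem?_eq_getElem hm, hms] using has

/-! ### Averages with small square mass -/

section SmallAverages

variable {f : ℕ → List ℕ →₀ ℝ} {C : ℝ}

/-- If for almost all pairs `j, k` some path carries a large mass of both `f j` and `f k`, then
some branch carries a large mass of infinitely many `f j`. -/
theorem exists_branch_of_frequently_pathMass
    (hC : ∀ j, SquareMassLE (f j) C)
    (hsep : ∀ j k, j < k → ∀ t ∈ (f j).support, ∀ s ∈ (f k).support, ¬ s <+: t)
    {η : ℝ} (hη : 0 < η)
    (hbad : ∀ᶠ j in (hyperfilter ℕ : Filter ℕ), ∀ᶠ k in (hyperfilter ℕ : Filter ℕ),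
      ∃ σ n, η ≤ pathMass (f j) σ n ∧ η ≤ pathMass (f k) σ n) :
    ∃ σ, ∃ᶠ j in atTop, ∃ n, η ≤ pathMass (f j) σ n := by
  classical
  have hgt : ∀ j : ℕ, ∀ᶠ k in (hyperfilter ℕ : Filter ℕ), j < k := fun j =>
    Nat.hyperfilter_le_atTop (eventually_gt_atTop j)
  choose d hd using fun k => (hC k).exists_cover hη
  have hpair : ∀ j k, j < k → (∃ σ n, η ≤ pathMass (f j) σ n ∧ η ≤ pathMass (f k) σ n) →
      ∃ t ∈ (f j).support, ∃ m, (∃ σ, branchNode σ t.length = t ∧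
        η ≤ pathMass (f j) σ (t.length + 1)) ∧ t <+: d k m := by
    -- Take for `t` the last support node of `f j` on the common heavy path. By separation it comes
    -- before the support node of `f k` supplied by the cover, so it is an initial segment of `d k
    -- m`.
    rintro j k hjk ⟨σ, n, h1, h2⟩
    obtain ⟨m, i, hi, his, hid⟩ := hd k σ n h2
    have hne : ((Finset.range n).filter fun i => branchNode σ i ∈ (f j).support).Nonempty := by
      by_contra hne
      rw [Finset.not_nonempty_iff_eq_empty, Finset.filter_eq_empty_iff] at hne
      have : pathMass (f j) σ n = 0 := Finset.sum_eq_zero fun i hi => by simpa using hne hi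
      linarith
    obtain ⟨a, ha, hmax⟩ := Finset.exists_max_image _ id hne
    rw [Finset.mem_filter, Finset.mem_range] at ha
    refine ⟨branchNode σ a, ha.2, m, ⟨σ, by simp, ?_⟩, ?_⟩
    · refine h1.trans (le_of_eq ?_)
      rw [branchNode_length]
      symm
      refine Finset.sum_subset (Finset.range_subset_range.2 ha.1) fun i hi hia => ?_
      by_contra h0
      have := hmax i (Finset.mem_filter.2 ⟨hi, Finsupp.mem_support_iff.2 h0⟩)
      simp at hia this
      omega
    · refine (branchNode_prefix σ (le_of_not_ge fun hia => ?_)).trans hid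
      exact hsep j k hjk _ ha.2 _ his (branchNode_prefix σ hia)
  -- For fixed `j` there are finitely many candidates `t` and `m`, so the ultrafilter fixes both for
  -- almost all `k`. The number of values of `m` is independent of `j` and `k`, so a single `m` then
  -- serves almost all `j`.
  have h1 : ∃ m, ∀ᶠ j in (hyperfilter ℕ : Filter ℕ), ∃ t ∈ (f j).support,
      (∃ σ, branchNode σ t.length = t ∧ η ≤ pathMass (f j) σ (t.length + 1)) ∧
      ∀ᶠ k in (hyperfilter ℕ : Filter ℕ), t <+: d k m := by
    rw [← Ultrafilter.eventually_exists_iff]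
    filter_upwards [hbad] with j hj
    have : ∀ᶠ k in (hyperfilter ℕ : Filter ℕ), ∃ t ∈ (f j).support, ∃ m,
        (∃ σ, branchNode σ t.length = t ∧ η ≤ pathMass (f j) σ (t.length + 1)) ∧ t <+: d k m := by
      filter_upwards [hj, hgt j] with k hk hjk using hpair j k hjk hk
    obtain ⟨t, ht, h⟩ := (Ultrafilter.eventually_exists_mem_iff
      (f := hyperfilter ℕ) (f j).support.finite_toSet).1 this
    obtain ⟨m, h⟩ := Ultrafilter.eventually_exists_iff.1 h
    rw [eventually_and, eventually_const] at h
    exact ⟨m, t, ht, h⟩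
  obtain ⟨m, hm⟩ := h1
  obtain ⟨J, hJ, hJm⟩ := hm.exists_mem
  have hJinf : J.Infinite := fun hfin => by
    have := hyperfilter_le_cofinite hfin.compl_mem_cofinite
    exact (Ultrafilter.compl_mem_iff_notMem.1 this) hJ
  choose! t ht1 ht2 ht3 using hJm
  -- Both nodes are initial segments of `d k m` for a common `k`.
  have hcmp : ∀ i ∈ J, ∀ j ∈ J, t i <+: t j ∨ t j <+: t i := by
    intro i hi j hj
    obtain ⟨k, hk1, hk2⟩ := ((ht3 i hi).and (ht3 j hj)).exists
    exact List.prefix_or_prefix_of_prefix hk1 hk2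
  have hlt : ∀ i ∈ J, ∀ j ∈ J, i < j → (t i).length < (t j).length := by
    intro i hi j hj hij
    by_contra hle
    refine hsep i j hij _ (ht1 i hi) _ (ht1 j hj) ?_
    rcases hcmp i hi j hj with h | h
    · rw [h.eq_of_length_le (not_lt.1 hle)]
    · exact h
  have hlen : ∀ n : ℕ, ∃ j ∈ J, n ≤ (t j).length := by
    intro n
    induction n with
    | zero => exact (hJinf.nonempty).imp fun j hj => ⟨hj, Nat.zero_le _⟩
    | succ n ih =>
      obtain ⟨i, hi, hn⟩ := ih
      obtain ⟨j, hj, hij⟩ := hJinf.exists_gt i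
      exact ⟨j, hj, hn.trans_lt (hlt i hi j hj hij)⟩
  obtain ⟨σ, hσ⟩ := exists_branch_of_chain (S := t '' J)
    (by rintro _ ⟨i, hi, rfl⟩ _ ⟨j, hj, rfl⟩; exact hcmp i hi j hj)
    (fun n => by obtain ⟨j, hj, h⟩ := hlen n; exact ⟨_, ⟨j, hj, rfl⟩, h⟩)
  refine ⟨σ, frequently_atTop.2 fun N => ?_⟩
  obtain ⟨j, hj, hNj⟩ := hJinf.exists_gt N
  refine ⟨j, hNj.le, (t j).length + 1, ?_⟩
  obtain ⟨τ, hτ, hmass⟩ := ht2 j hj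
  refine hmass.trans (le_of_eq (Finset.sum_congr rfl fun i hi => ?_))
  have hi' : i ≤ (t j).length := Nat.lt_succ_iff.1 (Finset.mem_range.1 hi)
  have e : branchNode τ (t j).length = branchNode σ (t j).length :=
    hτ.trans (hσ _ ⟨j, hj, rfl⟩)
  have h2 : branchNode τ i <+: branchNode σ (t j).length := e ▸ branchNode_prefix τ hi'
  rw [(prefix_branchNode_iff.1 h2).2, branchNode_length]

/-- The average of the functions `f j`, `j ∈ F`. -/
def averageOn (f : ℕ → List ℕ →₀ ℝ) (F : Finset ℕ) : List ℕ →₀ ℝ :=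
  (F.card : ℝ)⁻¹ • ∑ j ∈ F, f j

theorem massOn_averageOn (S : Set (List ℕ)) (F : Finset ℕ) :
    massOn S (averageOn f F) = (F.card : ℝ)⁻¹ * ∑ j ∈ F, massOn S (f j) := by
  simp [averageOn]

theorem averageOn_nonneg (hf : ∀ j t, 0 ≤ f j t) (F : Finset ℕ) (t : List ℕ) :
    0 ≤ averageOn f F t := by
  rw [averageOn, Finsupp.smul_apply, Finsupp.finsetSum_apply]
  exact smul_nonneg (by positivity) (Finset.sum_nonneg fun j _ => hf j t)

/-- Convexity of the square, applied on each segment. -/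
theorem SquareMassLE.averageOn (hC : ∀ j, SquareMassLE (f j) C) {F : Finset ℕ}
    (hF : F.Nonempty) : SquareMassLE (averageOn f F) C := by
  intro d S hS
  have hc : (0 : ℝ) < F.card := by exact_mod_cast hF.card_pos
  calc ∑ i, massOn (S i) (_root_.averageOn f F) ^ 2
      ≤ ∑ i, (F.card : ℝ)⁻¹ * ∑ j ∈ F, massOn (S i) (f j) ^ 2 := by
        refine Finset.sum_le_sum fun i _ => ?_
        rw [massOn_averageOn, mul_pow, sq (F.card : ℝ)⁻¹, mul_assoc]
        refine mul_le_mul_of_nonneg_left ?_ (by positivity)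
        rw [inv_mul_le_iff₀ hc]
        exact sq_sum_le_card_mul_sum_sq
    _ = (F.card : ℝ)⁻¹ * ∑ j ∈ F, ∑ i, massOn (S i) (f j) ^ 2 := by
        rw [← Finset.mul_sum, Finset.sum_comm]
    _ ≤ (F.card : ℝ)⁻¹ * ∑ j ∈ F, C := by
        refine mul_le_mul_of_nonneg_left (Finset.sum_le_sum fun j _ => hC j d S hS) (by positivity)
    _ = C := by
        rw [Finset.sum_const, nsmul_eq_mul, ← mul_assoc, inv_mul_cancel₀ hc.ne', one_mul]

/-- If the `f j` tend to zero on every branch, then some averages over Schreier sets are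
uniformly small on all paths. -/
theorem exists_averageOn_pathMass_le (hC : ∀ j, SquareMassLE (f j) C)
    (hsep : ∀ j k, j < k → ∀ t ∈ (f j).support, ∀ s ∈ (f k).support, ¬ s <+: t)
    (hnull : ∀ σ, ∀ δ > 0, ∀ᶠ j in atTop, ∀ n, pathMass (f j) σ n ≤ δ)
    {η : ℝ} (hη : 0 < η) (N : ℕ) :
    ∃ F : Finset ℕ, F.Nonempty ∧ (∀ a ∈ F, N ≤ a ∧ F.card ≤ a) ∧
      ∀ σ n, pathMass (averageOn f F) σ n ≤ η := by
  classical
  -- Otherwise, by the ultrafilter dichotomy, almost all pairs share a heavy path and some branch is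
  -- heavy for infinitely many `f j`, against `hnull`.
  have hgood : ∀ᶠ j in (hyperfilter ℕ : Filter ℕ), ∀ᶠ k in (hyperfilter ℕ : Filter ℕ),
      ¬ ∃ σ n, η / 2 ≤ pathMass (f j) σ n ∧ η / 2 ≤ pathMass (f k) σ n := by
    simp_rw [Ultrafilter.eventually_not]
    intro hbad
    obtain ⟨σ, hσ⟩ := exists_branch_of_frequently_pathMass hC hsep (half_pos hη) hbad
    obtain ⟨j, ⟨n, h1⟩, h2⟩ := (hσ.and_eventually (hnull σ (η / 4) (by positivity))).exists
    linarith [h2 n]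
  -- Among `m` functions at most one will be heavy on a given path, so the mean there is at most `η
  -- / 2 + √C / m`.
  obtain ⟨m, hm⟩ := exists_nat_gt (√C / (η / 2))
  have hm0 : (0 : ℝ) < m := lt_of_le_of_lt (by positivity) hm
  have hm0' : 0 < m := by exact_mod_cast hm0
  obtain ⟨g, hg1, hg2⟩ := exists_seq_of_forall_finset_exists
    (fun j => (N ≤ j ∧ m ≤ j) ∧ ∀ᶠ k in (hyperfilter ℕ : Filter ℕ),
      ¬ ∃ σ n, η / 2 ≤ pathMass (f j) σ n ∧ η / 2 ≤ pathMass (f k) σ n)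
    (fun j k => j < k ∧ ¬ ∃ σ n, η / 2 ≤ pathMass (f j) σ n ∧ η / 2 ≤ pathMass (f k) σ n) (by
      intro s hs
      have h1 : ∀ᶠ k in (hyperfilter ℕ : Filter ℕ), ∀ x ∈ s, x < k ∧
          ¬ ∃ σ n, η / 2 ≤ pathMass (f x) σ n ∧ η / 2 ≤ pathMass (f k) σ n := by
        rw [Filter.eventually_all_finset]
        exact fun x hx => Eventually.and (Nat.hyperfilter_le_atTop (eventually_gt_atTop x)) (hs x hx).2
      have h2 : ∀ᶠ k in (hyperfilter ℕ : Filter ℕ), N ≤ k ∧ m ≤ k :=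
        Nat.hyperfilter_le_atTop ((eventually_ge_atTop N).and (eventually_ge_atTop m))
      obtain ⟨k, ⟨hk1, hk2⟩, hk3⟩ := ((h1.and h2).and hgood).exists
      exact ⟨k, ⟨hk2, hk3⟩, hk1⟩)
  have hmono : StrictMono g := fun i j hij => (hg2 i j hij).1
  have hcard : ((Finset.range m).image g).card = m := by
    rw [Finset.card_image_of_injective _ hmono.injective, Finset.card_range]
  refine ⟨(Finset.range m).image g, by simpa using hm0'.ne', ?_, fun σ n => ?_⟩
  · intro a ha
    obtain ⟨i, -, rfl⟩ := Finset.mem_image.1 ha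
    rw [hcard]
    exact (hg1 i).1
  · rw [pathMass_eq_massOn, massOn_averageOn, hcard, inv_mul_le_iff₀ hm0,
      Finset.sum_image fun _ _ _ _ h => hmono.injective h]
    simp_rw [← pathMass_eq_massOn]
    have hB : ∀ i, pathMass (f (g i)) σ n ≤ √C := fun i => (hC _).pathMass_le σ n
    have key : ∑ i ∈ Finset.range m, pathMass (f (g i)) σ n ≤
        ∑ i ∈ Finset.range m, η / 2 + √C := by
      by_cases hex : ∃ i ∈ Finset.range m, η / 2 ≤ pathMass (f (g i)) σ n
      · obtain ⟨i, hi, hi2⟩ := hex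
        rw [← Finset.sum_erase_add _ _ hi]
        refine add_le_add ?_ (hB i)
        refine (Finset.sum_le_sum fun j hj => ?_).trans
          (Finset.sum_le_sum_of_subset_of_nonneg (Finset.erase_subset i _)
            fun _ _ _ => (half_pos hη).le)
        by_contra hlt
        have hj2 := (not_le.1 hlt).le
        rcases lt_or_gt_of_ne (Finset.ne_of_mem_erase hj) with h | h
        · exact (hg2 _ _ h).2 ⟨σ, n, hj2, hi2⟩
        · exact (hg2 _ _ h).2 ⟨σ, n, hi2, hj2⟩
      · push Not at hex
        exact (Finset.sum_le_sum fun i hi => (hex i hi).le).trans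
          (le_add_of_nonneg_right (Real.sqrt_nonneg _))
    rw [div_lt_iff₀ (half_pos hη)] at hm
    rw [Finset.sum_const, Finset.card_range, nsmul_eq_mul] at key
    linarith

/-- Averages of Schreier averages which are small for the square-mass norm. -/
theorem exists_average_squareMassLE (hf : ∀ j t, 0 ≤ f j t) (hC : ∀ j, SquareMassLE (f j) C)
    (hsep : ∀ j k, j < k → ∀ t ∈ (f j).support, ∀ s ∈ (f k).support, ¬ s <+: t)
    (hnull : ∀ σ, ∀ δ > 0, ∀ᶠ j in atTop, ∀ n, pathMass (f j) σ n ≤ δ)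
    {ε : ℝ} (hε : 0 < ε) :
    ∃ (n : ℕ) (F : Fin n → Finset ℕ), 0 < n ∧
      (∀ i, (F i).Nonempty ∧ ∀ a ∈ F i, n ≤ a ∧ (F i).card ≤ a) ∧
      (∀ i j, i < j → ∀ a ∈ F i, ∀ b ∈ F j, a < b) ∧
      SquareMassLE ((n : ℝ)⁻¹ • ∑ i, averageOn f (F i)) ε := by
  classical
  have hC0 : 0 ≤ C := (hC 0).nonneg
  -- The diagonal of the squared mean contributes at most `C / n`, which this choice makes at most
  -- `ε / 2`.
  obtain ⟨n, hn⟩ := exists_nat_gt (C / (ε / 2))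
  have hn0 : (0 : ℝ) < n := lt_of_le_of_lt (by positivity) hn
  have hn0' : 0 < n := by exact_mod_cast hn0
  -- Each new average is so small on paths that its product with the total mass of any earlier one
  -- is at most `ε / 2`. The starting bound also places it beyond all earlier sets.
  obtain ⟨G, hG1, hG2⟩ := exists_seq_of_forall_finset_exists
    (fun F : Finset ℕ => F.Nonempty ∧ ∀ a ∈ F, n ≤ a ∧ F.card ≤ a)
    (fun F G : Finset ℕ => (∀ a ∈ F, ∀ b ∈ G, a < b) ∧
      ∀ σ m, massOn univ (averageOn f F) * pathMass (averageOn f G) σ m ≤ ε / 2) (by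
      intro s hs
      let B : ℝ := ∑ F ∈ s, massOn univ (averageOn f F)
      have hB0 : ∀ F ∈ s, 0 ≤ massOn univ (averageOn f F) := fun F _ =>
        massOn_nonneg _ (averageOn_nonneg hf F)
      have hB : 0 ≤ B := Finset.sum_nonneg hB0
      have hη : 0 < ε / 2 / (B + 1) := by positivity
      obtain ⟨F, hF1, hF2, hF3⟩ := exists_averageOn_pathMass_le hC hsep hnull hη
        (max n (s.sup id |>.sup id) + 1)
      refine ⟨F, ⟨hF1, fun a ha => ⟨?_, (hF2 a ha).2⟩⟩, fun G hG => ⟨fun a ha b hb => ?_,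
        fun σ m => ?_⟩⟩
      · have := (hF2 a ha).1
        omega
      · have h1 := (hF2 b hb).1
        have h2 : a ≤ (s.sup id).sup id :=
          Finset.le_sup (f := id) (Finset.mem_sup.2 ⟨G, hG, ha⟩)
        omega
      · calc massOn univ (averageOn f G) * pathMass (averageOn f F) σ m
            ≤ (B + 1) * (ε / 2 / (B + 1)) := by
              refine mul_le_mul ?_ (hF3 σ m) (pathMass_nonneg (averageOn_nonneg hf F) σ m)
                (by positivity)
              linarith [Finset.single_le_sum hB0 hG]
          _ = ε / 2 := by field_simp)
  refine ⟨n, fun i => G i, hn0', fun i => hG1 i, fun i j hij => (hG2 i j hij).1, ?_⟩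
  intro d S hS
  -- The family shares out the total mass of the earlier average, while each member sees at most one
  -- path mass of the later one.
  have hcross : ∀ i j : ℕ, i < j →
      ∑ l, massOn (S l) (averageOn f (G i)) * massOn (S l) (averageOn f (G j)) ≤ ε / 2 := by
    intro i j hij
    have hpath : ∃ σ m, ∀ l, massOn (S l) (averageOn f (G j)) ≤
        pathMass (averageOn f (G j)) σ m := by
      choose σ m h using fun l => ((hS.1 l).2).exists_massOn_le_pathMass
        (averageOn_nonneg hf (G j))
      rcases isEmpty_or_nonempty (Fin d) with he | he
      · exact ⟨0, 0, fun l => he.elim l⟩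
      · obtain ⟨l, hl⟩ := Finite.exists_max fun l => pathMass (averageOn f (G j)) (σ l) (m l)
        exact ⟨σ l, m l, fun l' => (h l').trans (hl l')⟩
    obtain ⟨σ, m, h⟩ := hpath
    calc ∑ l, massOn (S l) (averageOn f (G i)) * massOn (S l) (averageOn f (G j))
        ≤ ∑ l, massOn (S l) (averageOn f (G i)) * pathMass (averageOn f (G j)) σ m :=
          Finset.sum_le_sum fun l _ => mul_le_mul_of_nonneg_left (h l)
            (massOn_nonneg _ (averageOn_nonneg hf _))
      _ ≤ massOn univ (averageOn f (G i)) * pathMass (averageOn f (G j)) σ m := by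
          rw [← Finset.sum_mul]
          exact mul_le_mul_of_nonneg_right (hS.sum_massOn_le (averageOn_nonneg hf _))
            (pathMass_nonneg (averageOn_nonneg hf _) σ m)
      _ ≤ ε / 2 := (hG2 i j hij).2 σ m
  have hall : ∀ i j : Fin n,
      ∑ l, massOn (S l) (averageOn f (G i)) * massOn (S l) (averageOn f (G j)) ≤
        ε / 2 + if i = j then C else 0 := by
    intro i j
    rcases lt_trichotomy i j with h | rfl | h
    · simpa [h.ne] using hcross i j h
    · simp only [if_true, ← sq]
      exact (SquareMassLE.averageOn hC (hG1 i).1 d S hS).trans (by linarith)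
    · simpa [h.ne', mul_comm] using hcross j i h
  calc ∑ l, massOn (S l) ((n : ℝ)⁻¹ • ∑ i : Fin n, averageOn f (G i)) ^ 2
      = ((n : ℝ)⁻¹) ^ 2 * ∑ i : Fin n, ∑ j : Fin n,
          ∑ l, massOn (S l) (averageOn f (G i)) * massOn (S l) (averageOn f (G j)) := by
        simp_rw [map_smul, map_sum, smul_eq_mul, mul_pow, sq (∑ i, _), Finset.sum_mul_sum]
        rw [← Finset.mul_sum, Finset.sum_comm]
        congr 1
        exact Finset.sum_congr rfl fun i _ => Finset.sum_comm
    _ ≤ ((n : ℝ)⁻¹) ^ 2 * ∑ i : Fin n, ∑ j : Fin n, (ε / 2 + if i = j then C else 0) := by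
        gcongr with i _ j _
        exact hall i j
    _ = ε / 2 + C / n := by
        simp only [Finset.sum_add_distrib, Finset.sum_const, Finset.card_univ, Fintype.card_fin,
          nsmul_eq_mul, Finset.sum_ite_eq, Finset.mem_univ, if_true]
        field_simp
    _ ≤ ε := by
        have : C / n ≤ ε / 2 := by
          rw [div_le_iff₀ hn0]
          rw [div_lt_iff₀ (half_pos hε)] at hn
          linarith
        linarith

end SmallAverages

/-! ### The node basis of `Z_{p,q}` -/

section TreeSpaceBasis

variable (p q : ℝ) [hp : Fact (1 ≤ p)] [hpq : Fact (p ≤ q)]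

/-- The inclusion of `c₀₀` into `Z_{p,q}`. -/
def treeEmb : (List ℕ →₀ ℝ) →ₗ[ℝ] TreeSpace p q :=
  (UniformSpace.Completion.toComplL (𝕜 := ℝ) (E := TreeC00 p q)).toLinearMap

theorem norm_treeEmb (z : List ℕ →₀ ℝ) : ‖treeEmb p q z‖ = treeNorm p q z :=
  UniformSpace.Completion.norm_coe (E := TreeC00 p q) z

theorem treeEmb_single (t : List ℕ) : treeEmb p q (Finsupp.single t 1) = nodeVector p q t := rfl

theorem denseRange_treeEmb : DenseRange (treeEmb p q) :=
  UniformSpace.Completion.denseRange_coe (α := TreeC00 p q)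

/-- The value at a node, as a functional on `c₀₀`. -/
def treeC00Coord (t : List ℕ) : TreeC00 p q →L[ℝ] ℝ :=
  LinearMap.mkContinuous (Finsupp.lapply t : (List ℕ →₀ ℝ) →ₗ[ℝ] ℝ) 1 fun z => by
    rw [one_mul]
    exact abs_apply_le_treeNorm hp.out (hp.out.trans hpq.out) z t

/-- The coordinate functional of a node. -/
def treeCoord (t : List ℕ) : TreeSpace p q →L[ℝ] ℝ :=
  (treeC00Coord p q t).extend (UniformSpace.Completion.toComplL (𝕜 := ℝ) (E := TreeC00 p q))

theorem treeCoord_treeEmb (t : List ℕ) (z : List ℕ →₀ ℝ) : treeCoord p q t (treeEmb p q z) = z t :=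
  ContinuousLinearMap.extend_eq (treeC00Coord p q t)
    (UniformSpace.Completion.denseRange_coe (α := TreeC00 p q))
    (UniformSpace.Completion.isUniformInducing_coe (TreeC00 p q)) z

-- This is 1-unconditionality of the nodes: coordinate projections become contractions.
variable {p q} in
theorem treeNorm_mono {z w : List ℕ →₀ ℝ} (h : ∀ t, |z t| ≤ |w t|) :
    treeNorm p q z ≤ treeNorm p q w := by
  classical
  have hq0 : 0 < q := by linarith [hp.out, hpq.out]
  have hp0 : 0 < p := by linarith [hp.out]
  refine treeNorm_le fun d S hS =>
    le_trans ?_ (le_treeNorm hp.out (hp.out.trans hpq.out) w hS)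
  have hsub : z.support ⊆ w.support := fun t ht => by
    rw [Finsupp.mem_support_iff] at ht ⊢
    rintro h0
    have := h t
    rw [h0, abs_zero] at this
    exact ht (abs_nonpos_iff.1 this)
  unfold segmentFamilyValue
  refine Real.rpow_le_rpow (Finset.sum_nonneg fun i _ => Real.rpow_nonneg
    (Finset.sum_nonneg fun t _ => Real.rpow_nonneg (abs_nonneg _) _) _)
    (Finset.sum_le_sum fun i _ => Real.rpow_le_rpow
      (Finset.sum_nonneg fun t _ => Real.rpow_nonneg (abs_nonneg _) _) ?_ (by positivity))
    (by positivity)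
  refine (Finset.sum_le_sum fun t _ => Real.rpow_le_rpow (abs_nonneg _) (h t) hp0.le).trans ?_
  exact Finset.sum_le_sum_of_subset_of_nonneg (Finset.filter_subset_filter _ hsub)
    fun t _ _ => Real.rpow_nonneg (abs_nonneg _) _

theorem treeEmb_sum_single (A : Finset (List ℕ)) (a : List ℕ → ℝ) :
    treeEmb p q (∑ t ∈ A, Finsupp.single t (a t)) = ∑ t ∈ A, a t • nodeVector p q t := by
  rw [map_sum]
  refine Finset.sum_congr rfl fun t _ => ?_
  rw [← treeEmb_single, ← map_smul, Finsupp.smul_single, smul_eq_mul, mul_one]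

/-- The coordinate projection onto finitely many nodes. -/
def treeProj (A : Finset (List ℕ)) : TreeSpace p q →L[ℝ] TreeSpace p q :=
  ∑ t ∈ A, (treeCoord p q t).smulRight (nodeVector p q t)

theorem treeProj_apply (A : Finset (List ℕ)) (y : TreeSpace p q) :
    treeProj p q A y = ∑ t ∈ A, treeCoord p q t y • nodeVector p q t := by
  simp [treeProj, _root_.sum_apply]

theorem treeProj_eq_treeEmb (A : Finset (List ℕ)) (y : TreeSpace p q) :
    treeProj p q A y = treeEmb p q (∑ t ∈ A, Finsupp.single t (treeCoord p q t y)) := by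
  rw [treeProj_apply, treeEmb_sum_single]

theorem sum_single_apply (A : Finset (List ℕ)) (a : List ℕ → ℝ) (s : List ℕ) :
    (∑ t ∈ A, Finsupp.single t (a t)) s = if s ∈ A then a s else 0 := by
  classical
  simp [Finsupp.finsetSum_apply, Finsupp.single_apply]

theorem norm_treeProj_le (A : Finset (List ℕ)) (y : TreeSpace p q) : ‖treeProj p q A y‖ ≤ ‖y‖ := by
  refine (denseRange_treeEmb p q).induction_on (p := fun y => ‖treeProj p q A y‖ ≤ ‖y‖) y
    (isClosed_le (by fun_prop) (by fun_prop)) fun z => ?_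
  rw [treeProj_eq_treeEmb, norm_treeEmb, norm_treeEmb]
  refine treeNorm_mono fun t => ?_
  rw [sum_single_apply]
  split_ifs
  · rw [treeCoord_treeEmb]
  · simp

theorem treeProj_treeEmb_of_subset {A : Finset (List ℕ)} {z : List ℕ →₀ ℝ} (h : z.support ⊆ A) :
    treeProj p q A (treeEmb p q z) = treeEmb p q z := by
  rw [treeProj_eq_treeEmb]
  congr 1
  ext s
  rw [sum_single_apply, treeCoord_treeEmb]
  split_ifs with hs
  · rfl
  · exact (Finsupp.notMem_support_iff.1 fun h' => hs (h h')).symm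

/-- Finite projections are contractions which fix a finitely supported vector once they cover its
support; density does the rest. -/
theorem hasSum_treeCoord (y : TreeSpace p q) :
    HasSum (fun t => treeCoord p q t y • nodeVector p q t) y := by
  rw [HasSum, SummationFilter.unconditional_filter, Metric.tendsto_atTop]
  intro ε hε
  obtain ⟨z, hz⟩ := (denseRange_treeEmb p q).exists_dist_lt y (half_pos hε)
  refine ⟨z.support, fun A hA => ?_⟩
  rw [← treeProj_apply, dist_eq_norm]
  rw [dist_eq_norm] at hz
  have h1 : treeProj p q A y - y =
      treeProj p q A (y - treeEmb p q z) - (y - treeEmb p q z) := by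
    rw [map_sub, treeProj_treeEmb_of_subset p q hA]
    abel
  rw [h1]
  calc _ ≤ ‖treeProj p q A (y - treeEmb p q z)‖ + ‖y - treeEmb p q z‖ := norm_sub_le _ _
    _ < ε := by linarith [norm_treeProj_le p q A (y - treeEmb p q z)]

/-- The node vectors form an unconditional basis. -/
def nodeBasis : UnconditionalSchauderBasis (List ℕ) ℝ (TreeSpace p q) where
  basis := nodeVector p q
  coord := treeCoord p q
  ortho s t := by
    rw [← treeEmb_single, treeCoord_treeEmb]
    by_cases h : s = t
    · subst h
      simp
    · rw [Finsupp.single_eq_of_ne h]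
      simp [Pi.single, Function.update, h]
  expansion := hasSum_treeCoord p q

/-- A reindexed unconditional basis. -/
def UnconditionalSchauderBasis.reindex {X β γ : Type*} [NormedAddCommGroup X] [NormedSpace ℝ X]
    (b : UnconditionalSchauderBasis β ℝ X) (e : γ ≃ β) : UnconditionalSchauderBasis γ ℝ X where
  basis i := b (e i)
  coord i := b.coord (e i)
  ortho i j := by
    classical
    rw [b.ortho, Pi.single_apply, Pi.single_apply]
    exact if_congr e.injective.eq_iff rfl rfl
  expansion x := (e.hasSum_iff (f := fun i => b.coord i x • b i)).2 (b.expansion x)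

end TreeSpaceBasis

/-! ### Norm estimates in `Y_p` -/

section YSpace

/-- The finitely supported function `t ↦ |z t| ^ p`. -/
def absPow (p : ℝ) [hp : Fact (1 ≤ p)] (z : List ℕ →₀ ℝ) : List ℕ →₀ ℝ :=
  z.mapRange (fun x => |x| ^ p) (by
    rw [abs_zero, Real.zero_rpow (by linarith [hp.out])])

variable {p : ℝ} [hp : Fact (1 ≤ p)]

@[simp] theorem absPow_apply (z : List ℕ →₀ ℝ) (t : List ℕ) : absPow p z t = |z t| ^ p := by
  simp [absPow]

theorem absPow_nonneg (z : List ℕ →₀ ℝ) (t : List ℕ) : 0 ≤ absPow p z t := by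
  rw [absPow_apply]; positivity

theorem absPow_support_subset (z : List ℕ →₀ ℝ) : (absPow p z).support ⊆ z.support :=
  Finsupp.support_mapRange

/-- The exponent `q / p` is 2: the choice `q = 2 * p` turns the norm into sums of squares. -/
theorem segmentFamilyValue_eq {d : ℕ} (S : Fin d → Set (List ℕ)) (z : List ℕ →₀ ℝ) :
    segmentFamilyValue p (2 * p) S z =
      (∑ i, massOn (S i) (absPow p z) ^ 2) ^ (1 / (2 * p)) := by
  have hp0 : p ≠ 0 := by linarith [hp.out]
  unfold segmentFamilyValue
  congr 1
  refine Finset.sum_congr rfl fun i _ => ?_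
  rw [massOn_eq_sum_filter _ _ (absPow_support_subset z), mul_div_cancel_right₀ _ hp0,
    Real.rpow_two]
  simp

theorem SquareMassLE.norm_treeEmb_le {z : List ℕ →₀ ℝ} {C : ℝ}
    (h : SquareMassLE (absPow p z) C) : ‖treeEmb p (2 * p) z‖ ≤ C ^ (1 / (2 * p)) := by
  have hp0 : 0 < p := by linarith [hp.out]
  rw [norm_treeEmb]
  refine treeNorm_le fun d S hS => ?_
  rw [segmentFamilyValue_eq]
  exact Real.rpow_le_rpow (Finset.sum_nonneg fun i _ => sq_nonneg _) (h d S hS) (by positivity)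

theorem squareMassLE_absPow (z : List ℕ →₀ ℝ) :
    SquareMassLE (absPow p z) (‖treeEmb p (2 * p) z‖ ^ (2 * p)) := by
  have hp0 : 0 < p := by linarith [hp.out]
  intro d S hS
  have h := le_treeNorm (q := 2 * p) hp.out (by linarith [hp.out]) z hS
  rw [segmentFamilyValue_eq, ← norm_treeEmb] at h
  rwa [one_div, Real.rpow_inv_le_iff_of_pos (Finset.sum_nonneg fun i _ => sq_nonneg _)
    (norm_nonneg _) (by positivity)] at h

/-- Segments of the family are disjoint and a sum of squares is at most the square of the sum, so
the `ℓ_p` norm dominates. -/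
theorem norm_treeEmb_le (z : List ℕ →₀ ℝ) :
    ‖treeEmb p (2 * p) z‖ ≤ massOn univ (absPow p z) ^ (1 / p) := by
  have h0 := massOn_nonneg univ (absPow_nonneg (p := p) z)
  have h : SquareMassLE (absPow p z) (massOn univ (absPow p z) ^ 2) := fun d S hS => by
    refine le_trans ?_ (pow_le_pow_left₀ (Finset.sum_nonneg fun i _ => massOn_nonneg _
      (absPow_nonneg z)) (hS.sum_massOn_le (absPow_nonneg (p := p) z)) 2)
    exact Finset.sum_sq_le_sq_sum_of_nonneg fun i _ => massOn_nonneg _ (absPow_nonneg z)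
  refine h.norm_treeEmb_le.trans (le_of_eq ?_)
  rw [← Real.rpow_natCast, ← Real.rpow_mul h0]
  congr 1
  have hp0 : p ≠ 0 := by linarith [hp.out]
  push_cast
  field_simp

/-- An initial part of a branch is a single segment; density carries the bound to the completion. -/
theorem sum_branch_treeCoord_le (y : YSpace p) (σ : ℕ → ℕ) (n : ℕ) :
    ∑ i ∈ Finset.range n, |treeCoord p (2 * p) (branchNode σ i) y| ^ p ≤ ‖y‖ ^ p := by
  have hp0 : 0 < p := by linarith [hp.out]
  refine (denseRange_treeEmb p (2 * p)).induction_on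
    (p := fun y => ∑ i ∈ Finset.range n, |treeCoord p (2 * p) (branchNode σ i) y| ^ p ≤ ‖y‖ ^ p) y
    (isClosed_le ?_ ?_) fun z => ?_
  · exact continuous_finsetSum _ fun i _ =>
      (continuous_abs.comp (treeCoord p (2 * p) _).continuous).rpow_const fun _ => Or.inr hp0.le
  · exact continuous_norm.rpow_const fun _ => Or.inr hp0.le
  · have h := (squareMassLE_absPow (p := p) z).pathMass_le σ n
    simp only [treeCoord_treeEmb]
    simp only [pathMass, absPow_apply] at h
    refine h.trans (le_of_eq ?_)
    rw [Real.sqrt_eq_rpow, ← Real.rpow_mul (norm_nonneg _)]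
    congr 1
    field_simp

end YSpace

/-! ### Block subsequences with respect to an unconditional basis -/

section Blocks

variable {β E : Type*} [NormedAddCommGroup E] [NormedSpace ℝ E]

theorem UnconditionalSchauderBasis.tendsto_proj_atTop (b : UnconditionalSchauderBasis β ℝ E)
    (x : E) : Tendsto (fun A => GeneralSchauderBasis.proj b A x) atTop (𝓝 x) := by
  have := GeneralSchauderBasis.tendsto_proj b x
  rwa [SummationFilter.unconditional_filter] at this

/-- A coordinatewise null sequence has a subsequence which is close to a block sequence. -/
theorem UnconditionalSchauderBasis.exists_block_subseq (b : UnconditionalSchauderBasis β ℝ E)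
    {w : ℕ → E} (hw : ∀ i, Tendsto (fun k => b.coord i (w k)) atTop (𝓝 0))
    {Good : Finset β → Prop} (hGood : ∀ B, ∃ A, B ⊆ A ∧ Good A)
    {ε : ℕ → ℝ} (hε : ∀ n, 0 < ε n) :
    ∃ (φ : ℕ → ℕ) (W : ℕ → Finset β), StrictMono φ ∧
      (∀ n, ‖w (φ n) - GeneralSchauderBasis.proj b (W n) (w (φ n))‖ ≤ ε n) ∧
      ∀ j k, j < k → ∃ A, Good A ∧ W j ⊆ A ∧ Disjoint A (W k) := by
  classical
  have hproj : ∀ A : Finset β, Tendsto (fun k => GeneralSchauderBasis.proj b A (w k)) atTop (𝓝 0) := by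
    intro A
    simp_rw [GeneralSchauderBasis.proj_apply]
    have := tendsto_finsetSum A fun i _ => (hw i).smul_const (b i)
    simpa using this
  -- Gliding hump: a late vector is almost zero on the current good set, and a larger good set
  -- captures it up to `ε n / 2`.
  have step : ∀ (n : ℕ) (s : ℕ × {A : Finset β // Good A}), ∃ s' : ℕ × {A : Finset β // Good A},
      s.1 < s'.1 ∧ s.2.1 ⊆ s'.2.1 ∧ ‖GeneralSchauderBasis.proj b s.2.1 (w s'.1)‖ ≤ ε n / 2 ∧
        ‖w s'.1 - GeneralSchauderBasis.proj b s'.2.1 (w s'.1)‖ ≤ ε n / 2 := by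
    rintro n ⟨k, A, hA⟩
    have h1 := (tendsto_zero_iff_norm_tendsto_zero.1 (hproj A)).eventually_le_const
      (half_pos (hε n))
    obtain ⟨k', hk', hkk'⟩ := (h1.and (eventually_gt_atTop k)).exists
    have h2 := ((tendsto_const_nhds (x := w k')).sub
      (b.tendsto_proj_atTop (w k'))).norm
    rw [sub_self, norm_zero] at h2
    obtain ⟨B, hB⟩ := eventually_atTop.1 (h2.eventually_le_const (half_pos (hε n)))
    obtain ⟨A', hA', hgood⟩ := hGood (A ∪ B)
    exact ⟨⟨k', A', hgood⟩, hkk', Finset.subset_union_left.trans hA', hk',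
      hB A' (Finset.subset_union_right.trans hA')⟩
  choose g hg1 hg2 hg3 hg4 using step
  obtain ⟨A₀, -, hA₀⟩ := hGood ∅
  let st : ℕ → ℕ × {A : Finset β // Good A} := fun n => Nat.rec (0, ⟨A₀, hA₀⟩) (fun n s => g n s) n
  have hst : ∀ n, st (n + 1) = g n (st n) := fun n => rfl
  have hmono : Monotone fun n => (st n).2.1 := monotone_nat_of_le_succ fun n => by
    rw [hst]; exact hg2 n (st n)
  refine ⟨fun n => (st (n + 1)).1, fun n => (st (n + 1)).2.1 \ (st n).2.1,
    strictMono_nat_of_lt_succ fun n => ?_, fun n => ?_, fun j k hjk => ?_⟩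
  · rw [hst (n + 1)]; exact hg1 _ _
  · have h : GeneralSchauderBasis.proj b ((st (n + 1)).2.1 \ (st n).2.1) (w (st (n + 1)).1) =
        GeneralSchauderBasis.proj b (st (n + 1)).2.1 (w (st (n + 1)).1) -
          GeneralSchauderBasis.proj b (st n).2.1 (w (st (n + 1)).1) := by
      simp_rw [GeneralSchauderBasis.proj_apply]
      rw [eq_sub_iff_add_eq]
      exact Finset.sum_sdiff (hmono (Nat.le_succ n))
    rw [h, sub_sub_eq_add_sub, add_sub_right_comm, hst n]
    exact (norm_add_le _ _).trans (by linarith [hg3 n (st n), hg4 n (st n)])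
  · exact ⟨(st (j + 1)).2.1, (st (j + 1)).2.2, Finset.sdiff_subset,
      Finset.disjoint_sdiff.mono_left (hmono hjk)⟩

/-- Extension of a bounded assignment on the basis to an operator. -/
theorem UnconditionalSchauderBasis.exists_operator {Y : Type*} [NormedAddCommGroup Y]
    [NormedSpace ℝ Y] [CompleteSpace Y] (b : UnconditionalSchauderBasis β ℝ E) (y : β → Y) (K : ℝ)
    (h : ∀ a : β →₀ ℝ, ‖Finsupp.linearCombination ℝ y a‖ ≤
      K * ‖Finsupp.linearCombination ℝ b a‖) :
    ∃ T : E →L[ℝ] Y, (∀ i, T (b i) = y i) ∧ ∀ x, ‖T x‖ ≤ K * ‖x‖ := by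
  have hd : DenseRange (Finsupp.linearCombination ℝ b.basis) := by
    intro x
    refine mem_closure_of_tendsto (b.tendsto_proj_atTop x) (Eventually.of_forall fun A => ?_)
    rw [GeneralSchauderBasis.proj_apply]
    refine ⟨∑ i ∈ A, Finsupp.single i (b.coord i x), ?_⟩
    simp [map_sum]
  refine ⟨(Finsupp.linearCombination ℝ y).extendOfNorm (Finsupp.linearCombination ℝ b.basis),
    fun i => ?_, LinearMap.norm_extendOfNorm_apply_le hd K h⟩
  have := LinearMap.extendOfNorm_eq hd ⟨K, h⟩ (Finsupp.single i (1 : ℝ))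
  simpa using this

end Blocks

/-! ### The unit vector basis of `ℓ_p` -/

section EllP

variable (p : ℝ) [hp : Fact (1 ≤ p)]

theorem toReal_ofReal_exponent : (ENNReal.ofReal p).toReal = p :=
  ENNReal.toReal_ofReal (by linarith [hp.out])

/-- The unit vectors of `ℓ_p`. -/
def unitVec (n : ℕ) : EllP p := lp.single (ENNReal.ofReal p) n (1 : ℝ)

/-- The unit vector basis of `ℓ_p`. -/
def unitBasis : UnconditionalSchauderBasis ℕ ℝ (EllP p) where
  basis := unitVec p
  coord n := lp.evalCLM ℝ (fun _ : ℕ => ℝ) (ENNReal.ofReal p) n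
  ortho i j := by
    by_cases h : i = j
    · subst h
      simp [unitVec, lp.evalCLM]
    · simp [unitVec, lp.evalCLM, Pi.single, Function.update, h]
  expansion x := by
    have h := lp.hasSum_single (p := ENNReal.ofReal p) ENNReal.ofReal_ne_top x
    convert! h using 2 with n
    rw [unitVec, ← lp.single_smul]
    simp [lp.evalCLM]

theorem unitBasis_apply (n : ℕ) : unitBasis p n = unitVec p n := rfl

theorem unitBasis_coord_apply (n : ℕ) (x : EllP p) : (unitBasis p).coord n x = x n := rfl

theorem hasSum_rpow_norm (x : EllP p) : HasSum (fun n => |x n| ^ p) (‖x‖ ^ p) := by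
  have hp0 : 0 < (ENNReal.ofReal p).toReal := by
    rw [toReal_ofReal_exponent]; linarith [hp.out]
  simpa [toReal_ofReal_exponent] using lp.hasSum_norm hp0 x

theorem abs_apply_le_norm (x : EllP p) (n : ℕ) : |x n| ≤ ‖x‖ := by
  have := lp.norm_apply_le_norm (p := ENNReal.ofReal p)
    (by simpa using by linarith [hp.out]) x n
  simpa using this

theorem unitComb_apply (a : ℕ →₀ ℝ) (n : ℕ) :
    (Finsupp.linearCombination ℝ (unitVec p) a : EllP p) n = a n := by
  have h := (unitBasis p).ortho n
  have : (unitBasis p).coord n (Finsupp.linearCombination ℝ (unitVec p) a) = a n := by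
    rw [Finsupp.linearCombination_apply, Finsupp.sum, map_sum]
    simp_rw [map_smul, ← unitBasis_apply, h, smul_eq_mul]
    rw [Finset.sum_eq_single n]
    · simp
    · intro m _ hm
      simp [Pi.single, Function.update, hm.symm]
    · intro hn
      simp [Finsupp.notMem_support_iff.1 hn]
  exact this

theorem norm_unitComb_rpow (a : ℕ →₀ ℝ) :
    ‖Finsupp.linearCombination ℝ (unitVec p) a‖ ^ p = ∑ n ∈ a.support, |a n| ^ p := by
  have hp0 : p ≠ 0 := by linarith [hp.out]
  refine (hasSum_rpow_norm p _).unique ?_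
  simp_rw [unitComb_apply]
  exact hasSum_sum_of_ne_finset_zero fun n hn => by
    rw [Finsupp.notMem_support_iff.1 hn, abs_zero, Real.zero_rpow hp0]

variable {p}

theorem abs_sum_rpow_of_disjoint {ι : Type*} (s : Finset ι) (x : ι → ℝ)
    (h : ∀ i ∈ s, ∀ j ∈ s, i ≠ j → x i = 0 ∨ x j = 0) :
    |∑ i ∈ s, x i| ^ p = ∑ i ∈ s, |x i| ^ p := by
  have hp0 : p ≠ 0 := by linarith [hp.out]
  by_cases hex : ∃ i ∈ s, x i ≠ 0
  · obtain ⟨i, hi, hxi⟩ := hex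
    have h0 : ∀ j ∈ s, j ≠ i → x j = 0 := fun j hj hji =>
      (h j hj i hi hji).resolve_right hxi
    rw [Finset.sum_eq_single_of_mem i hi h0, Finset.sum_eq_single_of_mem i hi]
    intro j hj hji
    rw [h0 j hj hji, abs_zero, Real.zero_rpow hp0]
  · push Not at hex
    rw [Finset.sum_eq_zero hex, abs_zero, Real.zero_rpow hp0, Finset.sum_eq_zero]
    intro i hi
    rw [hex i hi, abs_zero, Real.zero_rpow hp0]

theorem abs_linearCombination_rpow_of_disjoint (a : ℕ →₀ ℝ) (x : ℕ → ℝ)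
    (h : ∀ i j, i ≠ j → x i = 0 ∨ x j = 0) :
    |Finsupp.linearCombination ℝ x a| ^ p = ∑ k ∈ a.support, |a k| ^ p * |x k| ^ p := by
  rw [Finsupp.linearCombination_apply, Finsupp.sum, abs_sum_rpow_of_disjoint]
  · refine Finset.sum_congr rfl fun k _ => ?_
    rw [smul_eq_mul, abs_mul, Real.mul_rpow (abs_nonneg _) (abs_nonneg _)]
  · intro i _ j _ hij
    refine (h i j hij).imp ?_ ?_ <;> intro h <;> simp [h]

/-- Disjointly supported vectors of `ℓ_p`. -/
theorem norm_linearCombination_rpow_of_disjoint {v : ℕ → EllP p}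
    (h : ∀ i j, i ≠ j → ∀ n, v i n = 0 ∨ v j n = 0) (a : ℕ →₀ ℝ) :
    ‖Finsupp.linearCombination ℝ v a‖ ^ p = ∑ k ∈ a.support, |a k| ^ p * ‖v k‖ ^ p := by
  refine (hasSum_rpow_norm p _).unique ?_
  have h1 : ∀ n, |(Finsupp.linearCombination ℝ v a : EllP p) n| ^ p =
      ∑ k ∈ a.support, |a k| ^ p * |v k n| ^ p := by
    intro n
    rw [← abs_linearCombination_rpow_of_disjoint a (fun k => v k n) fun i j hij => h i j hij n]
    congr 2
    rw [Finsupp.linearCombination_apply, Finsupp.linearCombination_apply, Finsupp.sum, Finsupp.sum,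
      ← unitBasis_coord_apply, map_sum]
    rfl
  simp_rw [h1]
  exact hasSum_sum fun k _ => (hasSum_rpow_norm p (v k)).mul_left _

theorem rpow_norm_unitComb_mul (a : ℕ →₀ ℝ) {c : ℝ} (hc : 0 ≤ c) :
    (c * ‖Finsupp.linearCombination ℝ (unitVec p) a‖) ^ p =
      ∑ k ∈ a.support, |a k| ^ p * c ^ p := by
  rw [Real.mul_rpow hc (norm_nonneg _), norm_unitComb_rpow, Finset.mul_sum]
  exact Finset.sum_congr rfl fun _ _ => mul_comm _ _

/-- Small perturbations of a sequence of vectors have little effect on linear combinations. -/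
theorem norm_linearCombination_sub_le {E : Type*} [NormedAddCommGroup E] [NormedSpace ℝ E]
    {u v : ℕ → E} {η : ℝ} (hη : 0 ≤ η) (h : ∀ k, ‖u k - v k‖ ≤ η / 2 / 2 ^ k) (a : ℕ →₀ ℝ) :
    ‖Finsupp.linearCombination ℝ u a - Finsupp.linearCombination ℝ v a‖ ≤
      η * ‖Finsupp.linearCombination ℝ (unitVec p) a‖ := by
  rw [Finsupp.linearCombination_apply, Finsupp.linearCombination_apply, Finsupp.sum, Finsupp.sum,
    ← Finset.sum_sub_distrib]
  refine (norm_sum_le _ _).trans ?_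
  set N := ‖Finsupp.linearCombination ℝ (unitVec p) a‖
  calc ∑ k ∈ a.support, ‖a k • u k - a k • v k‖ ≤ ∑ k ∈ a.support, η / 2 / 2 ^ k * N := by
        refine Finset.sum_le_sum fun k _ => ?_
        rw [← smul_sub, norm_smul, mul_comm]
        refine mul_le_mul (h k) ?_ (norm_nonneg _) (by positivity)
        rw [Real.norm_eq_abs, ← unitComb_apply p a k]
        exact abs_apply_le_norm p _ k
    _ = (∑ k ∈ a.support, η / 2 / 2 ^ k) * N := by rw [Finset.sum_mul]
    _ ≤ η * N := by
        refine mul_le_mul_of_nonneg_right ?_ (norm_nonneg _)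
        exact ((summable_geometric_two' η).sum_le_tsum _ fun k _ => by positivity).trans_eq
          (tsum_geometric_two' η)

end EllP

/-! ### Operators fixing a copy of `ℓ_p`, and blocks of vectors together with their images -/

/-- An operator which is bounded below on a sequence equivalent to the unit vectors of `ℓ_p` is not
strictly singular. -/
theorem not_isStrictlySingular_of_lower_estimate (p : ℝ) [hp : Fact (1 ≤ p)] {X Y : Type*}
    [NormedAddCommGroup X] [NormedSpace ℝ X] [NormedAddCommGroup Y] [NormedSpace ℝ Y]
    (T : X →Lₚₜ[ℝ] Y) (u : ℕ → X) {c C : ℝ} (hc : 0 < c)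
    (hu : ∀ a, ‖Finsupp.linearCombination ℝ u a‖ ≤ C * ‖Finsupp.linearCombination ℝ (unitVec p) a‖)
    (hT : ∀ a, c * ‖Finsupp.linearCombination ℝ (unitVec p) a‖ ≤
      ‖T (Finsupp.linearCombination ℝ u a)‖) : ¬ IsStrictlySingular T := by
  have hT0 : T 0 = 0 := map_zero (show X →L[ℝ] Y from T)
  have hli : LinearIndependent ℝ u := by
    rw [linearIndependent_iff]
    intro a ha
    have h := hT a
    rw [ha, hT0, norm_zero] at h
    have h0 : ‖Finsupp.linearCombination ℝ (unitVec p) a‖ = 0 :=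
      le_antisymm (by nlinarith [norm_nonneg (Finsupp.linearCombination ℝ (unitVec p) a)])
        (norm_nonneg _)
    rw [norm_eq_zero] at h0
    ext n
    rw [← unitComb_apply p a n, h0]
    rfl
  intro hS
  refine hS (Submodule.span ℝ (range u)) (fun hfd => ?_) ⟨c / (|C| + 1), by positivity, ?_⟩
  · have := (linearIndependent_span hli).finite
    exact not_finite ℕ
  · intro z hz
    obtain ⟨a, rfl⟩ := (Finsupp.mem_span_range_iff_exists_finsupp).1 hz
    have e : (a.sum fun i r => r • u i) = Finsupp.linearCombination ℝ u a := rfl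
    rw [e]
    refine le_trans ?_ (hT a)
    rw [div_mul_eq_mul_div, div_le_iff₀ (by positivity), mul_assoc]
    refine mul_le_mul_of_nonneg_left ((hu a).trans ?_) hc.le
    rw [mul_comm]
    exact mul_le_mul_of_nonneg_left (by linarith [le_abs_self C]) (norm_nonneg _)

section Operators

variable {p : ℝ} [hp : Fact (1 ≤ p)]

theorem unitBasis_proj_apply (A : Finset ℕ) (x : EllP p) (n : ℕ) :
    (GeneralSchauderBasis.proj (unitBasis p) A x : EllP p) n = if n ∈ A then x n else 0 := by
  classical
  rw [← unitBasis_coord_apply, GeneralSchauderBasis.proj_apply, map_sum]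
  simp_rw [map_smul, (unitBasis p).ortho, unitBasis_coord_apply, smul_eq_mul]
  split_ifs with h
  · rw [Finset.sum_eq_single_of_mem n h]
    · simp
    · intro m _ hm
      simp [Pi.single, Function.update, hm.symm]
  · refine Finset.sum_eq_zero fun m hm => ?_
    have : n ≠ m := fun e => h (e ▸ hm)
    simp [Pi.single, Function.update, this]

theorem nodeBasis_proj_apply (A : Finset (List ℕ)) (y : YSpace p) :
    GeneralSchauderBasis.proj (nodeBasis p (2 * p)) A y = treeProj p (2 * p) A y := by
  rw [treeProj_apply, GeneralSchauderBasis.proj_apply]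
  rfl

theorem exists_prefixClosed (B : Finset (List ℕ)) :
    ∃ A : Finset (List ℕ), B ⊆ A ∧ ∀ t ∈ A, ∀ s, s <+: t → s ∈ A := by
  classical
  refine ⟨B.biUnion fun t => t.inits.toFinset, fun t ht => ?_, fun t ht s hst => ?_⟩
  · simp only [Finset.mem_biUnion, List.mem_toFinset, List.mem_inits]
    exact ⟨t, ht, List.prefix_rfl⟩
  · simp only [Finset.mem_biUnion, List.mem_toFinset, List.mem_inits] at ht ⊢
    obtain ⟨r, hr, htr⟩ := ht
    exact ⟨r, hr, hst.trans htr⟩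

/-- In the tree the good sets are the prefix-closed ones: a block disjoint from such a set contains
no initial segment of its nodes. The second extraction, in `ℓ_p`, preserves the first, and `k ≤ ψ k`
keeps the errors summable. -/
theorem exists_simultaneous_block_subseq (T : EllP p →L[ℝ] YSpace p) {u : ℕ → EllP p}
    (hu : ∀ n, Tendsto (fun k => u k n) atTop (𝓝 0))
    (hTu : ∀ t, Tendsto (fun k => treeCoord p (2 * p) t (T (u k))) atTop (𝓝 0))
    {η : ℝ} (hη : 0 < η) :
    ∃ (φ : ℕ → ℕ) (V : ℕ → Finset ℕ) (W : ℕ → Finset (List ℕ)), StrictMono φ ∧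
      (∀ k, ‖u (φ k) - GeneralSchauderBasis.proj (unitBasis p) (V k) (u (φ k))‖ ≤
        η / 2 / 2 ^ k) ∧
      (∀ k, ‖T (u (φ k)) - treeProj p (2 * p) (W k) (T (u (φ k)))‖ ≤ η / 2 / 2 ^ k) ∧
      (∀ j k, j ≠ k → Disjoint (V j) (V k)) ∧
      ∀ j k, j < k → ∀ t ∈ W j, ∀ s ∈ W k, ¬ s <+: t := by
  have hε : ∀ n : ℕ, 0 < η / 2 / 2 ^ n := fun n => by positivity
  obtain ⟨φ, W, hφ, h1, h2⟩ := (nodeBasis p (2 * p)).exists_block_subseq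
    (w := fun k => T (u k)) hTu exists_prefixClosed hε
  obtain ⟨ψ, V, hψ, h3, h4⟩ := (unitBasis p).exists_block_subseq (w := fun k => u (φ k))
    (fun i => (hu i).comp hφ.tendsto_atTop) (Good := fun _ => True)
    (fun B => ⟨B, subset_rfl, trivial⟩) hε
  refine ⟨φ ∘ ψ, V, W ∘ ψ, hφ.comp hψ, h3, fun k => ?_, fun j k hjk => ?_, fun j k hjk t ht s hs hst => ?_⟩
  · have := h1 (ψ k)
    rw [nodeBasis_proj_apply] at this
    refine this.trans ?_
    exact div_le_div_of_nonneg_left (by positivity) (by positivity)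
      (pow_le_pow_right₀ one_le_two (hψ.id_le k))
  · rcases lt_or_gt_of_ne hjk with h | h
    · obtain ⟨A, -, hA, hd⟩ := h4 j k h
      exact hd.mono_left hA
    · obtain ⟨A, -, hA, hd⟩ := h4 k j h
      exact (hd.mono_left hA).symm
  · obtain ⟨A, hA, hsub, hd⟩ := h2 _ _ (hψ hjk)
    exact Finset.disjoint_left.1 hd (hA t (hsub ht) s hst) hs

/-- Disjoint blocks add in `p`-th powers. One `η` pays for passing from `‖u k‖` to the norm of its
block, the other for replacing the whole combination. -/
theorem block_estimates {u : ℕ → EllP p} {V : ℕ → Finset ℕ} {η : ℝ} (hη : 0 ≤ η)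
    (h : ∀ k, ‖u k - GeneralSchauderBasis.proj (unitBasis p) (V k) (u k)‖ ≤ η / 2 / 2 ^ k)
    (hV : ∀ j k, j ≠ k → Disjoint (V j) (V k)) (a : ℕ →₀ ℝ) :
    (∀ C, (∀ k, ‖u k‖ ≤ C) → ‖Finsupp.linearCombination ℝ u a‖ ≤
      (C + 2 * η) * ‖Finsupp.linearCombination ℝ (unitVec p) a‖) ∧
    (∀ c, 2 * η ≤ c → (∀ k, c ≤ ‖u k‖) →
      (c - 2 * η) * ‖Finsupp.linearCombination ℝ (unitVec p) a‖ ≤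
        ‖Finsupp.linearCombination ℝ u a‖) := by
  have hp0 : 0 < p := by linarith [hp.out]
  set v : ℕ → EllP p := fun k => GeneralSchauderBasis.proj (unitBasis p) (V k) (u k) with hv
  have hle : ∀ k, ‖u k - v k‖ ≤ η := fun k => (h k).trans <| by
    rw [div_div]
    refine div_le_self hη ?_
    have : (1 : ℝ) ≤ 2 ^ k := one_le_pow₀ one_le_two
    linarith
  have hdisj : ∀ i j, i ≠ j → ∀ n, v i n = 0 ∨ v j n = 0 := by
    intro i j hij n
    simp only [hv, unitBasis_proj_apply]
    by_cases hi : n ∈ V i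
    · right
      rw [if_neg (Finset.disjoint_left.1 (hV i j hij) hi)]
    · left
      rw [if_neg hi]
  have hnorm := norm_linearCombination_rpow_of_disjoint hdisj a
  have hsub := norm_linearCombination_sub_le (p := p) hη h a
  set N := ‖Finsupp.linearCombination ℝ (unitVec p) a‖
  have hN : 0 ≤ N := norm_nonneg _
  constructor
  · intro C hC
    have hC0 : 0 ≤ C := (norm_nonneg _).trans (hC 0)
    have h1 : ‖Finsupp.linearCombination ℝ v a‖ ≤ (C + η) * N := by
      rw [← Real.rpow_le_rpow_iff (norm_nonneg _) (by positivity) hp0, hnorm,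
        rpow_norm_unitComb_mul a (by positivity)]
      refine Finset.sum_le_sum fun k _ => mul_le_mul_of_nonneg_left
        (Real.rpow_le_rpow (norm_nonneg _) ?_ hp0.le) (by positivity)
      have := norm_sub_norm_le (v k) (u k)
      rw [norm_sub_rev] at this
      linarith [hle k, hC k]
    have h2 := norm_sub_norm_le (Finsupp.linearCombination ℝ u a) (Finsupp.linearCombination ℝ v a)
    nlinarith
  · intro c hηc hc
    have h1 : (c - η) * N ≤ ‖Finsupp.linearCombination ℝ v a‖ := by
      rw [← Real.rpow_le_rpow_iff (mul_nonneg (by linarith) hN) (norm_nonneg _) hp0, hnorm,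
        rpow_norm_unitComb_mul a (by linarith)]
      refine Finset.sum_le_sum fun k _ => mul_le_mul_of_nonneg_left
        (Real.rpow_le_rpow (by linarith) ?_ hp0.le) (by positivity)
      have := norm_sub_norm_le (u k) (v k)
      linarith [hle k, hc k]
    have h2 := norm_sub_norm_le (Finsupp.linearCombination ℝ v a) (Finsupp.linearCombination ℝ u a)
    rw [norm_sub_rev] at h2
    nlinarith

/-- The finitely supported function with the same values as `y` on `A`. -/
def nodeRestrict (A : Finset (List ℕ)) (y : YSpace p) : List ℕ →₀ ℝ :=
  ∑ t ∈ A, Finsupp.single t (treeCoord p (2 * p) t y)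

theorem nodeRestrict_apply (A : Finset (List ℕ)) (y : YSpace p) (t : List ℕ) :
    nodeRestrict A y t = if t ∈ A then treeCoord p (2 * p) t y else 0 :=
  sum_single_apply A _ t

theorem treeEmb_nodeRestrict (A : Finset (List ℕ)) (y : YSpace p) :
    treeEmb p (2 * p) (nodeRestrict A y) = treeProj p (2 * p) A y :=
  (treeProj_eq_treeEmb p (2 * p) A y).symm

theorem mem_of_mem_support_nodeRestrict {A : Finset (List ℕ)} {y : YSpace p} {t : List ℕ}
    (h : t ∈ (nodeRestrict A y).support) : t ∈ A := by
  by_contra hA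
  rw [Finsupp.mem_support_iff, nodeRestrict_apply, if_neg hA] at h
  exact h rfl

/-- At each node at most one summand is nonzero. Masses of combinations thereby become linear in the
`|a k| ^ p`. -/
theorem absPow_linearCombination {z : ℕ → List ℕ →₀ ℝ}
    (hz : ∀ i j, i ≠ j → ∀ t, z i t = 0 ∨ z j t = 0) (a : ℕ →₀ ℝ) :
    absPow p (Finsupp.linearCombination ℝ z a) =
      ∑ k ∈ a.support, |a k| ^ p • absPow p (z k) := by
  ext t
  rw [absPow_apply, Finsupp.finsetSum_apply]
  simp only [Finsupp.smul_apply, absPow_apply, smul_eq_mul]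
  rw [← abs_linearCombination_rpow_of_disjoint a (fun k => z k t) fun i j hij => hz i j hij t]
  congr 2
  rw [Finsupp.linearCombination_apply, Finsupp.linearCombination_apply, Finsupp.sum, Finsupp.sum,
    Finsupp.finsetSum_apply]
  rfl

theorem disjoint_nodeRestrict {W : ℕ → Finset (List ℕ)} {y : ℕ → YSpace p}
    (hW : ∀ j k, j < k → ∀ t ∈ W j, ∀ s ∈ W k, ¬ s <+: t) (i j : ℕ) (hij : i ≠ j) (t : List ℕ) :
    nodeRestrict (W i) (y i) t = 0 ∨ nodeRestrict (W j) (y j) t = 0 := by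
  simp only [nodeRestrict_apply]
  by_cases hi : t ∈ W i
  · right
    refine if_neg fun hj => ?_
    rcases lt_or_gt_of_ne hij with h | h
    · exact hW i j h t hi t hj List.prefix_rfl
    · exact hW j i h t hj t hi List.prefix_rfl
  · exact Or.inl (if_neg hi)

theorem map_linearCombination_comp {X Y : Type*} [AddCommGroup X] [Module ℝ X] [AddCommGroup Y]
    [Module ℝ Y] (L : X →ₗ[ℝ] Y) (u : ℕ → X) (a : ℕ →₀ ℝ) :
    L (Finsupp.linearCombination ℝ u a) = Finsupp.linearCombination ℝ (fun k => L (u k)) a := by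
  rw [Finsupp.linearCombination_apply, Finsupp.linearCombination_apply, Finsupp.sum, Finsupp.sum,
    map_sum]
  simp

/-- If the images of a bounded coordinatewise null sequence do not tend to zero along some branch,
then `T` fixes a copy of `ℓ_p`. -/
theorem not_isStrictlySingular_of_branch (T : EllP p →Lₚₜ[ℝ] YSpace p) {u : ℕ → EllP p} {C : ℝ}
    (hC : ∀ k, ‖u k‖ ≤ C) (hu : ∀ n, Tendsto (fun k => u k n) atTop (𝓝 0))
    (hTu : ∀ t, Tendsto (fun k => treeCoord p (2 * p) t (T (u k))) atTop (𝓝 0))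
    (σ : ℕ → ℕ) {δ : ℝ} (hδ : 0 < δ)
    (hσ : ∃ᶠ k in atTop, ∃ n, δ <
      ∑ i ∈ Finset.range n, |treeCoord p (2 * p) (branchNode σ i) (T (u k))| ^ p) :
    ¬ IsStrictlySingular T := by
  have hp0 : 0 < p := by linarith [hp.out]
  obtain ⟨θ, hθ, hθσ⟩ := extraction_of_frequently_atTop hσ
  -- `d` is the `ℓ_p` size of the images on the branch. Truncation to `W k` costs at most `d / 4`
  -- and leaves at least `d / 2`; undoing it in a combination costs another `d / 4`, hence the final
  -- constant `d / 4`.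
  set d : ℝ := δ ^ (1 / p) with hd
  have hd0 : 0 < d := by positivity
  let T' : EllP p →L[ℝ] YSpace p := T
  obtain ⟨φ, V, W, hφ, h1, h2, h3, h4⟩ := exists_simultaneous_block_subseq T'
    (u := fun k => u (θ k)) (fun n => (hu n).comp hθ.tendsto_atTop)
    (fun t => (hTu t).comp hθ.tendsto_atTop) (η := d / 4) (by positivity)
  set w : ℕ → EllP p := fun k => u (θ (φ k)) with hw
  set z : ℕ → List ℕ →₀ ℝ := fun k => nodeRestrict (W k) (T' (w k)) with hz
  have hzd : ∀ k, ‖T' (w k) - treeEmb p (2 * p) (z k)‖ ≤ d / 4 / 2 / 2 ^ k := fun k => by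
    rw [hz, treeEmb_nodeRestrict]
    exact h2 k
  have hle : ∀ k, ‖T' (w k) - treeEmb p (2 * p) (z k)‖ ≤ d / 4 := fun k => (hzd k).trans <| by
    rw [div_div _ 2]
    refine div_le_self (by positivity) ?_
    have : (1 : ℝ) ≤ 2 ^ k := one_le_pow₀ one_le_two
    linarith
  have hlow : ∀ k, ∃ n, (d / 2) ^ p ≤ ∑ i ∈ Finset.range n, |z k (branchNode σ i)| ^ p := by
    intro k
    obtain ⟨n, hn⟩ := hθσ (φ k)
    refine ⟨n, ?_⟩
    have hm := Real.Lp_add_le (Finset.range n)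
      (fun i => treeCoord p (2 * p) (branchNode σ i) (T' (w k) - treeEmb p (2 * p) (z k)))
      (fun i => z k (branchNode σ i)) hp.out
    have e : ∀ i, treeCoord p (2 * p) (branchNode σ i) (T' (w k) - treeEmb p (2 * p) (z k)) +
        z k (branchNode σ i) = treeCoord p (2 * p) (branchNode σ i) (T' (w k)) := fun i => by
      rw [map_sub, treeCoord_treeEmb, sub_add_cancel]
    simp only [e] at hm
    have hA : d ≤ (∑ i ∈ Finset.range n,
        |treeCoord p (2 * p) (branchNode σ i) (T' (w k))| ^ p) ^ (1 / p) :=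
      Real.rpow_le_rpow hδ.le hn.le (by positivity)
    have hB : (∑ i ∈ Finset.range n, |treeCoord p (2 * p) (branchNode σ i)
        (T' (w k) - treeEmb p (2 * p) (z k))| ^ p) ^ (1 / p) ≤ d / 4 := by
      refine le_trans ?_ (hle k)
      rw [one_div, Real.rpow_inv_le_iff_of_pos (Finset.sum_nonneg fun i _ => by positivity)
        (norm_nonneg _) hp0]
      exact sum_branch_treeCoord_le _ σ n
    have hD : d / 2 ≤ (∑ i ∈ Finset.range n, |z k (branchNode σ i)| ^ p) ^ (1 / p) := by linarith
    rwa [one_div, Real.le_rpow_inv_iff_of_pos (by positivity)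
      (Finset.sum_nonneg fun i _ => by positivity) hp0] at hD
  choose n hn using hlow
  refine not_isStrictlySingular_of_lower_estimate p T w (c := d / 4) (C := C + 2 * (d / 4))
    (by positivity) (fun a => (block_estimates (by positivity) h1 h3 a).1 C fun k => hC _)
    fun a => ?_
  set N := ‖Finsupp.linearCombination ℝ (unitVec p) a‖
  have hZ : d / 2 * N ≤ ‖Finsupp.linearCombination ℝ (fun k => treeEmb p (2 * p) (z k)) a‖ := by
    rw [← map_linearCombination_comp,
      ← Real.rpow_le_rpow_iff (by positivity) (norm_nonneg _) hp0,
      rpow_norm_unitComb_mul a (by positivity)]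
    -- One piece of `σ`, long enough for every index in the support of `a`, tests all the blocks at
    -- once.
    refine le_trans ?_ (sum_branch_treeCoord_le _ σ (a.support.sup n))
    have e : ∀ i, |treeCoord p (2 * p) (branchNode σ i)
        (treeEmb p (2 * p) (Finsupp.linearCombination ℝ z a))| ^ p =
        ∑ k ∈ a.support, |a k| ^ p * |z k (branchNode σ i)| ^ p := fun i => by
      rw [treeCoord_treeEmb, ← absPow_apply,
        absPow_linearCombination (disjoint_nodeRestrict h4), Finsupp.finsetSum_apply]
      simp [hz]
    simp_rw [e]
    rw [Finset.sum_comm]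
    refine Finset.sum_le_sum fun k hk => ?_
    rw [← Finset.mul_sum]
    refine mul_le_mul_of_nonneg_left ((hn k).trans ?_) (by positivity)
    exact Finset.sum_le_sum_of_subset_of_nonneg
      (Finset.range_subset_range.2 (Finset.le_sup hk)) fun i _ _ => by positivity
  have hsub := norm_linearCombination_sub_le (p := p) (by positivity) hzd a
  have e2 : T (Finsupp.linearCombination ℝ w a) =
      Finsupp.linearCombination ℝ (fun k => T' (w k)) a :=
    map_linearCombination_comp T'.toLinearMap w a
  rw [e2]
  have h5 := norm_sub_norm_le (Finsupp.linearCombination ℝ (fun k => treeEmb p (2 * p) (z k)) a)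
    (Finsupp.linearCombination ℝ (fun k => T' (w k)) a)
  rw [norm_sub_rev] at h5
  linarith

end Operators

/-! ### Small combinations supported on sets of `S_2` -/

section Operators

/-- The coefficient of `j` in an average of averages. -/
def averageCoeff {n : ℕ} (F : Fin n → Finset ℕ) (j : ℕ) : ℝ :=
  ∑ i, if j ∈ F i then (n : ℝ)⁻¹ * ((F i).card : ℝ)⁻¹ else 0

theorem averageCoeff_nonneg {n : ℕ} (F : Fin n → Finset ℕ) (j : ℕ) : 0 ≤ averageCoeff F j :=
  Finset.sum_nonneg fun i _ => by split_ifs <;> positivity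

theorem average_eq_sum_averageCoeff {M : Type*} [AddCommGroup M] [Module ℝ M] {n : ℕ}
    (F : Fin n → Finset ℕ) (h : ℕ → M) :
    (n : ℝ)⁻¹ • ∑ i, ((F i).card : ℝ)⁻¹ • ∑ j ∈ F i, h j =
      ∑ j ∈ Finset.univ.biUnion F, averageCoeff F j • h j := by
  simp_rw [averageCoeff, Finset.sum_smul, Finset.smul_sum, smul_smul]
  rw [Finset.sum_comm]
  refine Finset.sum_congr rfl fun i _ => ?_
  simp_rw [ite_smul, zero_smul]
  rw [← Finset.sum_filter]
  refine Finset.sum_congr ?_ fun _ _ => rfl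
  ext j
  simp only [Finset.mem_filter, Finset.mem_biUnion, Finset.mem_univ, true_and]
  exact ⟨fun h => ⟨⟨i, h⟩, h⟩, fun h => h.2⟩

theorem sum_averageCoeff {n : ℕ} (hn : 0 < n) {F : Fin n → Finset ℕ} (hF : ∀ i, (F i).Nonempty) :
    ∑ j ∈ Finset.univ.biUnion F, averageCoeff F j = 1 := by
  have h := average_eq_sum_averageCoeff F fun _ => (1 : ℝ)
  simp only [smul_eq_mul, mul_one] at h
  rw [← h]
  have : ∀ i, ((F i).card : ℝ)⁻¹ * ∑ _j ∈ F i, (1 : ℝ) = 1 := fun i => by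
    rw [Finset.sum_const, nsmul_eq_mul, mul_one, inv_mul_cancel₀]
    exact_mod_cast (hF i).card_pos.ne'
  simp_rw [this]
  have : (n : ℝ) ≠ 0 := by exact_mod_cast hn.ne'
  simp [this]

variable {p : ℝ} [hp : Fact (1 ≤ p)]

/-- If the images of a bounded, seminormalized and coordinatewise null sequence tend to zero along
every branch, then they have small combinations supported on sets of the second Schreier family. -/
theorem exists_small_combination (T : EllP p →L[ℝ] YSpace p) {u : ℕ → EllP p} {c C : ℝ}
    (hc0 : 0 < c) (hc : ∀ k, c ≤ ‖u k‖) (hC : ∀ k, ‖u k‖ ≤ C)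
    (hu : ∀ n, Tendsto (fun k => u k n) atTop (𝓝 0))
    (hσ : ∀ σ, ∀ δ > 0, ∀ᶠ k in atTop, ∀ n,
      ∑ i ∈ Finset.range n, |treeCoord p (2 * p) (branchNode σ i) (T (u k))| ^ p ≤ δ)
    {ε : ℝ} (hε : 0 < ε) :
    ∃ (n : ℕ) (F : Fin n → Finset ℕ), 0 < n ∧
      (∀ i, (F i).Nonempty ∧ ∀ a ∈ F i, n ≤ a ∧ (F i).card ≤ a) ∧
      (∀ i j, i < j → ∀ a ∈ F i, ∀ b ∈ F j, a < b) ∧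
      ∃ v ∈ Submodule.span ℝ (u '' (Finset.univ.biUnion F)), v ≠ 0 ∧ ‖T v‖ ≤ ε * ‖v‖ := by
  have hp0 : 0 < p := by linarith [hp.out]
  have hC0 : 0 ≤ C := (norm_nonneg _).trans (hC 0)
  have hTu : ∀ t, Tendsto (fun k => treeCoord p (2 * p) t (T (u k))) atTop (𝓝 0) := by
    intro t
    obtain ⟨σ, hσt⟩ := exists_branchNode_eq t
    rw [Metric.tendsto_nhds]
    intro r hr
    filter_upwards [hσ σ ((r / 2) ^ p) (by positivity)] with k hk
    have h1 := (Finset.single_le_sum (f := fun i =>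
      |treeCoord p (2 * p) (branchNode σ i) (T (u k))| ^ p) (fun i _ => by positivity)
      (Finset.mem_range.2 (Nat.lt_succ_self t.length))).trans (hk (t.length + 1))
    simp only [hσt] at h1
    rw [Real.rpow_le_rpow_iff (abs_nonneg _) (by positivity) hp0] at h1
    rw [Real.dist_eq, sub_zero]
    linarith
  -- `η ≤ c / 4` keeps the norm of the combination at least `c / 2`, and `η ≤ ε * c / 4` makes the
  -- bound `2 * η` on its image at most `ε` times that.
  set η : ℝ := min (c / 4) (ε * c / 4) with hη
  have hη0 : 0 < η := by positivity
  have hη1 : η ≤ c / 4 := min_le_left _ _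
  have hη2 : η ≤ ε * c / 4 := min_le_right _ _
  obtain ⟨φ, V, W, hφ, h1, h2, h3, h4⟩ := exists_simultaneous_block_subseq T hu hTu hη0
  set w : ℕ → EllP p := fun k => u (φ k) with hw
  set z : ℕ → List ℕ →₀ ℝ := fun k => nodeRestrict (W k) (T (w k)) with hz
  have hzd : ∀ k, ‖T (w k) - treeEmb p (2 * p) (z k)‖ ≤ η / 2 / 2 ^ k := fun k => by
    rw [hz, treeEmb_nodeRestrict]
    exact h2 k
  have hzC : ∀ k, SquareMassLE (absPow p (z k)) ((‖T‖ * C) ^ (2 * p)) := by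
    intro k d S hS
    refine (squareMassLE_absPow (z k) d S hS).trans ?_
    refine Real.rpow_le_rpow (norm_nonneg _) ?_ (by positivity)
    rw [hz, treeEmb_nodeRestrict]
    exact (norm_treeProj_le _ _ _ _).trans
      ((T.le_opNorm _).trans (mul_le_mul_of_nonneg_left (hC _) (norm_nonneg _)))
  have hznull : ∀ σ, ∀ δ > 0, ∀ᶠ k in atTop, ∀ m, pathMass (absPow p (z k)) σ m ≤ δ := by
    intro σ δ hδ
    filter_upwards [hφ.tendsto_atTop.eventually (hσ σ δ hδ)] with k hk m
    refine le_trans (Finset.sum_le_sum fun i _ => ?_) (hk m)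
    rw [absPow_apply, hz, nodeRestrict_apply]
    split_ifs
    · exact le_rfl
    · rw [abs_zero, Real.zero_rpow hp0.ne']
      positivity
  obtain ⟨n, F, hn, hF1, hF2, hF3⟩ := exists_average_squareMassLE
    (fun k t => absPow_nonneg (p := p) (z k) t) hzC
    (fun j k hjk t ht s hs => h4 j k hjk t
      (mem_of_mem_support_nodeRestrict (absPow_support_subset _ ht)) s
      (mem_of_mem_support_nodeRestrict (absPow_support_subset _ hs)))
    hznull (ε := η ^ (2 * p)) (by positivity)
  -- With `p`-th roots of the averaging coefficients, the `|a j| ^ p` sum to one, and `absPow` of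
  -- the combination of truncated images is exactly the average of averages.
  let a : ℕ →₀ ℝ := Finsupp.onFinset (Finset.univ.biUnion F)
    (fun j => averageCoeff F j ^ (1 / p)) fun j hj => by
      by_contra hmem
      refine hj ?_
      have : averageCoeff F j = 0 := Finset.sum_eq_zero fun i _ => if_neg fun h =>
        hmem (Finset.mem_biUnion.2 ⟨i, Finset.mem_univ _, h⟩)
      simp only [this]
      exact Real.zero_rpow (by positivity)
  have ha : ∀ j, |a j| ^ p = averageCoeff F j := fun j => by
    have h0 := averageCoeff_nonneg F j
    rw [Finsupp.onFinset_apply, abs_of_nonneg (by positivity), ← Real.rpow_mul h0,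
      one_div_mul_cancel hp0.ne', Real.rpow_one]
  have hasum : ∀ {M : Type} [AddCommGroup M] [Module ℝ M] (h : ℕ → M),
      ∑ j ∈ a.support, |a j| ^ p • h j =
        ∑ j ∈ Finset.univ.biUnion F, averageCoeff F j • h j := by
    intro M _ _ h
    simp_rw [← ha]
    refine Finset.sum_subset Finsupp.support_onFinset_subset fun j _ hj => ?_
    rw [Finsupp.notMem_support_iff.1 hj, abs_zero, Real.zero_rpow hp0.ne', zero_smul]
  have hN : ‖Finsupp.linearCombination ℝ (unitVec p) a‖ = 1 := by
    have h := hasum fun _ => (1 : ℝ)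
    simp only [smul_eq_mul, mul_one] at h
    rw [sum_averageCoeff hn fun i => (hF1 i).1, ← norm_unitComb_rpow] at h
    exact (Real.rpow_left_inj (norm_nonneg _) zero_le_one hp0.ne').1 (by rw [h, Real.one_rpow])
  have hlow := (block_estimates hη0.le h1 h3 a).2 c (by linarith) fun k => hc _
  rw [hN, mul_one] at hlow
  have hup : ‖T (Finsupp.linearCombination ℝ w a)‖ ≤ 2 * η := by
    have hsub := norm_linearCombination_sub_le (p := p) hη0.le hzd a
    rw [hN, mul_one] at hsub
    have e2 : T (Finsupp.linearCombination ℝ w a) =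
        Finsupp.linearCombination ℝ (fun k => T (w k)) a :=
      map_linearCombination_comp T.toLinearMap w a
    have hZ : ‖Finsupp.linearCombination ℝ (fun k => treeEmb p (2 * p) (z k)) a‖ ≤ η := by
      rw [← map_linearCombination_comp]
      have e3 : absPow p (Finsupp.linearCombination ℝ z a) =
          (n : ℝ)⁻¹ • ∑ i, averageOn (fun k => absPow p (z k)) (F i) := by
        rw [absPow_linearCombination (disjoint_nodeRestrict h4), hasum]
        exact (average_eq_sum_averageCoeff F fun k => absPow p (z k)).symm
      rw [← e3] at hF3
      refine hF3.norm_treeEmb_le.trans (le_of_eq ?_)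
      rw [← Real.rpow_mul hη0.le, mul_one_div_cancel (by positivity), Real.rpow_one]
    rw [e2]
    have h5 := norm_sub_norm_le (Finsupp.linearCombination ℝ (fun k => T (w k)) a)
      (Finsupp.linearCombination ℝ (fun k => treeEmb p (2 * p) (z k)) a)
    linarith
  -- Since `b ≤ φ b`, moving the sets by `φ` preserves the Schreier bounds.
  refine ⟨n, fun i => (F i).map ⟨φ, hφ.injective⟩, hn, fun i => ⟨(hF1 i).1.map, fun x hx => ?_⟩,
    fun i j hij x hx y hy => ?_, Finsupp.linearCombination ℝ w a, ?_, fun h0 => ?_, ?_⟩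
  · obtain ⟨b, hb, rfl⟩ := Finset.mem_map.1 hx
    rw [Finset.card_map]
    have := hφ.id_le b
    exact ⟨((hF1 i).2 b hb).1.trans this, ((hF1 i).2 b hb).2.trans this⟩
  · obtain ⟨b, hb, rfl⟩ := Finset.mem_map.1 hx
    obtain ⟨b', hb', rfl⟩ := Finset.mem_map.1 hy
    exact hφ (hF2 i j hij b hb b' hb')
  · rw [Finsupp.linearCombination_apply, Finsupp.sum]
    refine Submodule.sum_mem _ fun j hj => Submodule.smul_mem _ _ (Submodule.subset_span ?_)
    obtain ⟨i, hi, hji⟩ := Finset.mem_biUnion.1 (Finsupp.support_onFinset_subset hj)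
    exact ⟨φ j, by simpa using ⟨i, j, hji, rfl⟩, rfl⟩
  · rw [h0, norm_zero] at hlow
    linarith
  · refine hup.trans ?_
    nlinarith

end Operators

/-! ### The rank of a strictly singular operator -/

theorem mem_schreier_one (c : LimitSequences) {F : Finset ℕ} (hF : ∀ a ∈ F, F.card ≤ a) :
    F ∈ schreier c (0 + 1) := by
  rw [schreier, Ordinal.limitRecOn_add_one, Ordinal.limitRecOn_zero]
  refine ⟨F.card, fun i => {F.orderEmbOfFin rfl i}, fun i => ⟨by simp, by simp⟩,
    fun i j hij a ha b hb => ?_, hF, ?_⟩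
  · rw [Finset.mem_singleton] at ha hb
    rw [ha, hb]
    exact (F.orderEmbOfFin rfl).strictMono hij
  · ext a
    have : a ∈ F ↔ a ∈ Set.range (F.orderEmbOfFin rfl) := by
      rw [Finset.range_orderEmbOfFin]; rfl
    rw [this, mem_range]
    simp only [Finset.mem_biUnion, Finset.mem_univ, true_and, Finset.mem_singleton]
    exact exists_congr fun _ => eq_comm

/-- Only the stages 0, 1 and 2 of the recursion enter, so the sequences chosen at limit ordinals
play no role. -/
theorem mem_schreier_two (c : LimitSequences) {n : ℕ} {F : Fin n → Finset ℕ}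
    (hF : ∀ i, (F i).Nonempty ∧ ∀ a ∈ F i, n ≤ a ∧ (F i).card ≤ a)
    (hlt : ∀ i j, i < j → ∀ a ∈ F i, ∀ b ∈ F j, a < b) :
    Finset.univ.biUnion F ∈ schreier c 2 := by
  have h2 : (2 : Ordinal.{0}) = 0 + 1 + 1 := by rw [zero_add, one_add_one_eq_two]
  rw [h2, schreier, Ordinal.limitRecOn_add_one]
  refine ⟨n, F, fun i => ⟨mem_schreier_one c fun a ha => ((hF i).2 a ha).2, (hF i).1⟩, hlt,
    fun a ha => ?_, by congr⟩
  obtain ⟨i, -, hi⟩ := Finset.mem_biUnion.1 ha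
  exact ((hF i).2 a hi).1

/-- A normalized basic sequence is separated. -/
theorem IsBasicSequence.exists_le_norm_sub {X : Type*} [NormedAddCommGroup X] [NormedSpace ℝ X]
    [CompleteSpace X] {x : ℕ → X} (hx : IsBasicSequence x) (h1 : ∀ n, ‖x n‖ = 1) :
    ∃ c > 0, ∀ i j, i ≠ j → c ≤ ‖x i - x j‖ := by
  obtain ⟨b, hb⟩ := hx
  obtain ⟨C, hC⟩ := b.exists_norm_proj_le
  have hC0 : 0 ≤ C := (norm_nonneg _).trans (hC 0)
  refine ⟨1 / (2 * C + 1), by positivity, fun i j hij => ?_⟩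
  rw [div_le_iff₀ (by positivity)]
  -- Two consecutive partial-sum projections isolate `x i`, so `1 ≤ 2 * C * ‖x i - x j‖`; the `+ 1`
  -- in the constant avoids a division by zero.
  have e : b.proj (i + 1) (b i - b j) - b.proj i (b i - b j) = b i := by
    rw [map_sub, map_sub]
    simp_rw [SchauderBasis.proj_apply_basis_mem]
    rcases lt_or_gt_of_ne hij with h | h
    · simp [h.not_ge, h.not_gt]
    · simp [h, h.le]
  have h2 : ‖(b i - b j : (Submodule.span ℝ (range x)).topologicalClosure)‖ = ‖x i - x j‖ := by
    rw [← hb, ← hb]; rfl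
  have h3 : ‖(b i : (Submodule.span ℝ (range x)).topologicalClosure)‖ = 1 := by
    rw [← h1 i, ← hb]; rfl
  have h6 := norm_sub_le (b.proj (i + 1) (b i - b j)) (b.proj i (b i - b j))
  rw [e, h3] at h6
  rw [← h2]
  have h4 := ((b.proj (i + 1)).le_opNorm (b i - b j)).trans
    (mul_le_mul_of_nonneg_right (hC _) (norm_nonneg _))
  have h5 := ((b.proj i).le_opNorm (b i - b j)).trans
    (mul_le_mul_of_nonneg_right (hC _) (norm_nonneg _))
  nlinarith [norm_nonneg (b i - b j)]

/-- A bounded sequence has a subsequence along which countably many functionals converge. -/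
theorem exists_subseq_tendsto_functionals {ι X : Type*} [Countable ι] [NormedAddCommGroup X]
    [NormedSpace ℝ X] (L : ι → X →L[ℝ] ℝ) {x : ℕ → X} (h1 : ∀ n, ‖x n‖ = 1) :
    ∃ ψ : ℕ → ℕ, StrictMono ψ ∧ ∀ i, ∃ l, Tendsto (fun k => L i (x (ψ k))) atTop (𝓝 l) := by
  -- A countable product of compact intervals is metrizable, so compactness yields a subsequence.
  have hcomp : IsCompact (Set.univ.pi fun i => Icc (-‖L i‖) ‖L i‖) :=
    isCompact_univ_pi fun i => isCompact_Icc
  obtain ⟨l, -, ψ, hψ, h⟩ := hcomp.tendsto_subseq (x := fun k i => L i (x k)) fun k i _ => by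
    rw [mem_Icc, ← abs_le]
    simpa [h1] using (L i).le_opNorm (x k)
  exact ⟨ψ, hψ, fun i => ⟨l i, (tendsto_pi_nhds.1 h) i⟩⟩

section Operators

variable {p : ℝ} [hp : Fact (1 ≤ p)]

/-- Differences along a suitable subsequence are seminormalized and coordinatewise null, together
with their images. Strict singularity excludes a branch on which the images persist, so
`exists_small_combination` applies. -/
theorem isSchreierStrictlySingular_two (c : LimitSequences) {T : EllP p →Lₚₜ[ℝ] YSpace p}
    (hT : IsStrictlySingular T) : IsSchreierStrictlySingular c 2 T := by
  intro x hx h1 ε hε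
  obtain ⟨d, hd, hsep⟩ := hx.exists_le_norm_sub h1
  let T' : EllP p →L[ℝ] YSpace p := T
  let L : ℕ ⊕ List ℕ → EllP p →L[ℝ] ℝ :=
    Sum.elim (fun n => (unitBasis p).coord n) (fun t => (treeCoord p (2 * p) t).comp T')
  obtain ⟨ψ, hψ, hL⟩ := exists_subseq_tendsto_functionals L h1
  set u : ℕ → EllP p := fun k => x (ψ (2 * k + 1)) - x (ψ (2 * k)) with hu
  have hLu : ∀ i, Tendsto (fun k => L i (u k)) atTop (𝓝 0) := by
    intro i
    obtain ⟨l, hl⟩ := hL i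
    have h2 : Tendsto (fun k : ℕ => 2 * k) atTop atTop :=
      tendsto_atTop_mono (fun k => show k ≤ 2 * k by omega) tendsto_id
    have h3 : Tendsto (fun k : ℕ => 2 * k + 1) atTop atTop := 
      tendsto_atTop_mono (fun k => show 2 * k ≤ 2 * k + 1 by omega) h2
    simpa [hu] using (hl.comp h3).sub (hl.comp h2)
  have hC : ∀ k, ‖u k‖ ≤ 2 := fun k => (norm_sub_le _ _).trans (by rw [h1, h1]; norm_num)
  have hc : ∀ k, d ≤ ‖u k‖ := fun k => hsep _ _ (hψ.injective.ne (by omega))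
  have hσ : ∀ σ, ∀ δ > 0, ∀ᶠ k in atTop, ∀ n,
      ∑ i ∈ Finset.range n, |treeCoord p (2 * p) (branchNode σ i) (T' (u k))| ^ p ≤ δ := by
    intro σ δ hδ
    by_contra hcon
    rw [not_eventually] at hcon
    refine not_isStrictlySingular_of_branch T hC (fun n => hLu (Sum.inl n))
      (fun t => hLu (Sum.inr t)) σ hδ (hcon.mono fun k hk => ?_) hT
    push Not at hk
    exact hk
  obtain ⟨n, F, hn, hF1, hF2, v, hv, hv0, hTv⟩ := exists_small_combination T' hd hc hC
    (fun n => hLu (Sum.inl n)) hσ hε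
  -- Each `u j` involves two vectors, which may double the cardinality, but their numbers are at
  -- least `2 * j + 1`, so the Schreier bounds survive. The `+ 1` is the shift between positions and
  -- numbers.
  let G : Fin n → Finset ℕ := fun i =>
    (F i).biUnion fun j => {ψ (2 * j) + 1, ψ (2 * j + 1) + 1}
  have hG : ∀ i a, a ∈ G i ↔ ∃ j ∈ F i, a = ψ (2 * j) + 1 ∨ a = ψ (2 * j + 1) + 1 := fun i a => by
    simp [G]
  have hGmem : ∀ i a, a ∈ G i → ∃ j ∈ F i, 2 * j + 1 ≤ a ∧ ψ (2 * j) + 1 ≤ a ∧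
      a ≤ ψ (2 * j + 1) + 1 := by
    intro i a ha
    obtain ⟨j, hj, h⟩ := (hG i a).1 ha
    have h2 := hψ.id_le (2 * j)
    have h3 := hψ (Nat.lt_succ_self (2 * j))
    simp only [id, Nat.succ_eq_add_one] at h2 h3
    refine ⟨j, hj, ?_⟩
    omega
  have hnorm : 0 < ‖v‖ := norm_pos_iff.2 hv0
  refine ⟨Finset.univ.biUnion G, mem_schreier_two c (fun i => ⟨?_, fun a ha => ?_⟩)
    (fun i j hij a ha b hb => ?_), ?_, ‖v‖⁻¹ • v, Submodule.smul_mem _ _ ?_, ?_, ?_⟩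
  · obtain ⟨j, hj⟩ := (hF1 i).1
    exact ⟨_, (hG i _).2 ⟨j, hj, Or.inl rfl⟩⟩
  · obtain ⟨j, hj, h2, -⟩ := hGmem i a ha
    obtain ⟨h3, h4⟩ := (hF1 i).2 j hj
    have h5 : (G i).card ≤ (F i).card * 2 :=
      Finset.card_biUnion_le_card_mul _ _ _ fun j _ => Finset.card_le_two
    omega
  · obtain ⟨k, hk, -, -, h2⟩ := hGmem i a ha
    obtain ⟨l, hl, -, h3, -⟩ := hGmem j b hb
    have h4 := hF2 i j hij k hk l hl
    have h5 := hψ (show 2 * k + 1 < 2 * l by omega)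
    omega
  · obtain ⟨j, hj⟩ := (hF1 ⟨0, hn⟩).1
    exact ⟨_, Finset.mem_biUnion.2 ⟨⟨0, hn⟩, Finset.mem_univ _, (hG _ _).2 ⟨j, hj, Or.inl rfl⟩⟩⟩
  · refine Submodule.span_le.2 ?_ hv
    rintro _ ⟨j, hj, rfl⟩
    obtain ⟨i, -, hi⟩ := Finset.mem_biUnion.1 (Finset.mem_coe.1 hj)
    refine Submodule.sub_mem _ (Submodule.subset_span ⟨_, ?_, rfl⟩)
      (Submodule.subset_span ⟨_, ?_, rfl⟩)
    · exact Finset.mem_biUnion.2 ⟨i, Finset.mem_univ _, (hG _ _).2 ⟨j, hi, Or.inr rfl⟩⟩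
    · exact Finset.mem_biUnion.2 ⟨i, Finset.mem_univ _, (hG _ _).2 ⟨j, hi, Or.inl rfl⟩⟩
  · rw [norm_smul, norm_inv, norm_norm, inv_mul_cancel₀ hnorm.ne']
  · change ‖T' (‖v‖⁻¹ • v)‖ ≤ ε
    rw [map_smul, norm_smul, norm_inv, norm_norm, inv_mul_le_iff₀ hnorm, mul_comm ‖v‖ ε]
    exact hTv

theorem rho_le_two (c : LimitSequences) {T : EllP p →Lₚₜ[ℝ] YSpace p}
    (hT : IsStrictlySingular T) : rho c T ≤ 2 :=
  csInf_le' (Or.inr ⟨one_le_two, by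
    exact_mod_cast (Ordinal.natCast_lt_omega0 2).trans Ordinal.omega0_lt_omega_one,
    isSchreierStrictlySingular_two c hT⟩)

/-- An operator which tends to zero along all branches on bounded coordinatewise null sequences is
strictly singular. -/
theorem isStrictlySingular_of_branch (T : EllP p →Lₚₜ[ℝ] YSpace p)
    (hT : ∀ u : ℕ → EllP p, (∀ n, Tendsto (fun k => u k n) atTop (𝓝 0)) →
      ∀ σ, ∀ δ > 0, ∀ᶠ k in atTop, ∀ n,
      ∑ i ∈ Finset.range n, |treeCoord p (2 * p) (branchNode σ i) (T (u k))| ^ p ≤ δ) :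
    IsStrictlySingular T := by
  rintro Z hZ ⟨c, hc, hcT⟩
  -- Finitely many coordinates cannot separate the points of an infinite-dimensional space; this
  -- gives a normalized coordinatewise null sequence inside `Z`.
  have hex : ∀ N : ℕ, ∃ z ∈ Z, ‖z‖ = 1 ∧ ∀ n < N, z n = 0 := by
    intro N
    let R : Z →ₗ[ℝ] (Fin N → ℝ) :=
      LinearMap.pi fun i => ((unitBasis p).coord i).toLinearMap ∘ₗ Z.subtype
    have hR : ¬ Function.Injective R := fun h => hZ (FiniteDimensional.of_injective R h)
    rw [← LinearMap.ker_eq_bot, Submodule.eq_bot_iff] at hR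
    push Not at hR
    obtain ⟨z, hz, hz0⟩ := hR
    have hn : ‖(z : EllP p)‖ ≠ 0 := norm_ne_zero_iff.2 fun h => hz0 (Subtype.ext h)
    refine ⟨‖(z : EllP p)‖⁻¹ • (z : EllP p), Z.smul_mem _ z.2, ?_, fun n hn' => ?_⟩
    · rw [norm_smul, norm_inv, norm_norm, inv_mul_cancel₀ hn]
    · have : (z : EllP p) n = 0 := congrFun (LinearMap.mem_ker.1 hz) ⟨n, hn'⟩
      rw [lp.coeFn_smul, Pi.smul_apply, this, smul_zero]
  choose u huZ hu1 hu0 using hex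
  have hu : ∀ n, Tendsto (fun k => u k n) atTop (𝓝 0) := fun n =>
    tendsto_const_nhds.congr' ((eventually_gt_atTop n).mono fun k hk => (hu0 k n hk).symm)
  obtain ⟨n, F, -, -, -, v, hv, hv0, hTv⟩ := exists_small_combination
    (show EllP p →L[ℝ] YSpace p from T) zero_lt_one (fun k => (hu1 k).ge) (fun k => (hu1 k).le) hu
    (hT u hu) (half_pos hc)
  have hvZ : v ∈ Z := Submodule.span_le.2 (by rintro _ ⟨j, -, rfl⟩; exact huZ j) hv
  have h1 := hcT v hvZ
  have h2 : 0 < ‖v‖ := norm_pos_iff.2 hv0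
  have h3 : ‖T v‖ ≤ c / 2 * ‖v‖ := hTv
  nlinarith

end Operators

/-! ### The space of operators is standard Borel -/

section Basis

variable {β E : Type*} [NormedAddCommGroup E] [NormedSpace ℝ E]

theorem UnconditionalSchauderBasis.dense_span (b : UnconditionalSchauderBasis β ℝ E) :
    Dense (Submodule.span ℝ (range b.basis) : Set E) := fun y =>
  mem_closure_of_tendsto (b.tendsto_proj_atTop y) (Eventually.of_forall fun A => by
    rw [GeneralSchauderBasis.proj_apply]
    exact Submodule.sum_mem _ fun t _ => Submodule.smul_mem _ _ (Submodule.subset_span ⟨t, rfl⟩))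

theorem UnconditionalSchauderBasis.separableSpace [Countable β]
    (b : UnconditionalSchauderBasis β ℝ E) : TopologicalSpace.SeparableSpace E := by
  have h := (countable_range b.basis).isSeparable.span (R := ℝ) |>.closure
  rw [b.dense_span.closure_eq] at h
  exact TopologicalSpace.isSeparable_univ_iff.1 h

theorem UnconditionalSchauderBasis.ext_operator {Y : Type*} [NormedAddCommGroup Y]
    [NormedSpace ℝ Y] (b : UnconditionalSchauderBasis β ℝ E) {S T : E →L[ℝ] Y}
    (h : ∀ i, S (b i) = T (b i)) : S = T :=
  ContinuousLinearMap.ext_on b.dense_span (by rintro _ ⟨i, rfl⟩; exact h i)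

end Basis

section OperatorSpace

variable {X Y : Type*} [NormedAddCommGroup X] [NormedSpace ℝ X] [NormedAddCommGroup Y]
  [NormedSpace ℝ Y]

instance : BorelSpace (X →Lₚₜ[ℝ] Y) := ⟨rfl⟩

/-- The values of an operator on a basis. -/
def evalBasis (b : UnconditionalSchauderBasis ℕ ℝ X) (T : X →Lₚₜ[ℝ] Y) (n : ℕ) : Y := T (b n)

/-- The values on a basis of the operators of norm at most `K`. -/
def boundedValues (Y : Type*) [NormedAddCommGroup Y] [NormedSpace ℝ Y]
    (b : UnconditionalSchauderBasis ℕ ℝ X) (K : ℝ) : Set (ℕ → Y) :=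
  {y | ∀ a : ℕ →₀ ℝ, ‖Finsupp.linearCombination ℝ y a‖ ≤
    K * ‖Finsupp.linearCombination ℝ b.basis a‖}

variable (b : UnconditionalSchauderBasis ℕ ℝ X)

theorem isClosed_boundedValues (K : ℝ) : IsClosed (boundedValues Y b K) := by
  rw [boundedValues, ofPred_forall]
  refine isClosed_iInter fun a => isClosed_le (Continuous.norm ?_) continuous_const
  simp_rw [Finsupp.linearCombination_apply, Finsupp.sum]
  fun_prop

theorem evalBasis_injective : Function.Injective (evalBasis (Y := Y) b) := fun S T h =>
  b.ext_operator (S := S) (T := T) fun i => congrFun h i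

theorem evalBasis_mem_boundedValues {K : ℝ} (T : X →Lₚₜ[ℝ] Y) :
    evalBasis b T ∈ boundedValues Y b K ↔ ∀ x, ‖T x‖ ≤ K * ‖x‖ := by
  let T' : X →L[ℝ] Y := T
  have e : ∀ a : ℕ →₀ ℝ, Finsupp.linearCombination ℝ (evalBasis b T) a =
      T' (Finsupp.linearCombination ℝ b.basis a) := fun a =>
    (map_linearCombination_comp T'.toLinearMap b.basis a).symm
  simp only [boundedValues, mem_ofPred_eq, e]
  refine ⟨fun h x => ?_, fun h a => h _⟩
  have hc : IsClosed {x | ‖T' x‖ ≤ K * ‖x‖} := isClosed_le (by fun_prop) (by fun_prop)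
  refine hc.closure_subset_iff.2 ?_ (b.dense_span x)
  intro z hz
  rw [SetLike.mem_coe, ← Finsupp.range_linearCombination] at hz
  obtain ⟨a, rfl⟩ := hz
  exact h a

theorem range_evalBasis [CompleteSpace Y] :
    range (evalBasis (Y := Y) b) = ⋃ K : ℕ, boundedValues Y b K := by
  ext y
  rw [mem_iUnion]
  constructor
  · rintro ⟨T, rfl⟩
    let T' : X →L[ℝ] Y := T
    obtain ⟨K, hK⟩ := exists_nat_ge ‖T'‖
    exact ⟨K, (evalBasis_mem_boundedValues b T).2 fun x =>
      (T'.le_opNorm x).trans (mul_le_mul_of_nonneg_right hK (norm_nonneg _))⟩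
  · rintro ⟨K, hK⟩
    obtain ⟨T, hT, -⟩ := b.exists_operator y K hK
    exact ⟨T, funext hT⟩

theorem continuous_evalBasis : Continuous (evalBasis (Y := Y) b) :=
  continuous_pi fun n => PointwiseConvergenceCLM.continuousEvalConst.continuous_eval_const (b n)

/-- On bounded sets, convergence on the basis implies strong convergence. -/
theorem comap_evalBasis_inf_le_nhds {K : ℝ} {T : X →Lₚₜ[ℝ] Y}
    (hT : evalBasis b T ∈ boundedValues Y b K) :
    comap (evalBasis b) (𝓝 (evalBasis b T)) ⊓ 𝓟 (evalBasis b ⁻¹' boundedValues Y b K) ≤ 𝓝 T := by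
  set l := comap (evalBasis b) (𝓝 (evalBasis b T)) ⊓ 𝓟 (evalBasis b ⁻¹' boundedValues Y b K)
  have key : Tendsto id l (𝓝 T) := by
    rw [PointwiseConvergenceCLM.tendsto_iff_forall_tendsto]
    intro x
    have hb : ∀ n, Tendsto (fun S : X →Lₚₜ[ℝ] Y => S (b n)) l (𝓝 (T (b n))) := fun n =>
      ((tendsto_pi_nhds.1 (tendsto_comap (f := evalBasis b) (x := 𝓝 (evalBasis b T)))) n).mono_left
        inf_le_left
    have hspan : ∀ z ∈ Submodule.span ℝ (range b.basis),
        Tendsto (fun S : X →Lₚₜ[ℝ] Y => S z) l (𝓝 (T z)) := by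
      intro z hz
      induction hz using Submodule.span_induction with
      | mem z hz => obtain ⟨n, rfl⟩ := hz; exact hb n
      | zero =>
        have : ∀ S : X →Lₚₜ[ℝ] Y, S 0 = 0 := fun S => map_zero (show X →L[ℝ] Y from S)
        simp only [this]
        exact tendsto_const_nhds
      | add z w _ _ h1 h2 =>
        have : ∀ S : X →Lₚₜ[ℝ] Y, S (z + w) = S z + S w := fun S =>
          map_add (show X →L[ℝ] Y from S) z w
        simp only [this]
        exact h1.add h2
      | smul c z _ h1 =>
        have : ∀ S : X →Lₚₜ[ℝ] Y, S (c • z) = c • S z := fun S =>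
          map_smul (show X →L[ℝ] Y from S) c z
        simp only [this]
        exact h1.const_smul c
    rw [Metric.tendsto_nhds]
    intro ε hε
    obtain ⟨z, hz, hxz⟩ := b.dense_span.exists_dist_lt x
      (show 0 < ε / (3 * (|K| + 1)) by positivity)
    rw [dist_eq_norm, lt_div_iff₀ (by positivity)] at hxz
    have hbd : ∀ S : X →Lₚₜ[ℝ] Y, evalBasis b S ∈ boundedValues Y b K → ‖S x - S z‖ < ε / 3 := by
      intro S hS
      have h1 : S (x - z) = S x - S z := map_sub (show X →L[ℝ] Y from S) x z
      have h2 := (evalBasis_mem_boundedValues b S).1 hS (x - z)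
      rw [h1] at h2
      have h3 : K * ‖x - z‖ ≤ |K| * ‖x - z‖ :=
        mul_le_mul_of_nonneg_right (le_abs_self K) (norm_nonneg _)
      have h4 := norm_nonneg (x - z)
      have h5 := abs_nonneg K
      rcases h4.eq_or_lt with h6 | h6
      · rw [← h6] at h2
        linarith
      · nlinarith
    have hmem : ∀ᶠ S in l, evalBasis b S ∈ boundedValues Y b K :=
      Filter.mem_of_superset (mem_inf_of_right (mem_principal_self _)) fun _ h => h
    filter_upwards [Metric.tendsto_nhds.1 (hspan z hz) (ε / 3) (by positivity), hmem] with S h1 h2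
    rw [dist_eq_norm] at h1 ⊢
    have h3 := hbd S h2
    have h4 := hbd T hT
    have e : id S x - T x = (S x - S z) + (S z - T z) - (T x - T z) := by
      simp only [id]; abel
    rw [e]
    calc _ ≤ ‖S x - S z‖ + ‖S z - T z‖ + ‖T x - T z‖ :=
          (norm_sub_le _ _).trans (add_le_add_left (norm_add_le _ _) _)
      _ < ε := by linarith
  exact key

variable [CompleteSpace Y] [TopologicalSpace.SeparableSpace Y] [MeasurableSpace Y] [BorelSpace Y]

theorem measurable_evalBasis : Measurable (evalBasis (Y := Y) b) :=
  (continuous_evalBasis b).measurable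

/-- The range is a countable union of closed sets, and on operators of norm at most `K` strong
convergence is convergence on the basis. -/
theorem measurableEmbedding_evalBasis : MeasurableEmbedding (evalBasis (Y := Y) b) := by
  refine ⟨evalBasis_injective b, measurable_evalBasis b, fun s hs => ?_⟩
  have hrange : MeasurableSet (range (evalBasis (Y := Y) b)) := by
    rw [range_evalBasis]
    exact MeasurableSet.iUnion fun K => (isClosed_boundedValues b K).measurableSet
  have hle : borel (X →Lₚₜ[ℝ] Y) ≤ MeasurableSpace.comap (evalBasis b) inferInstance := by
    refine MeasurableSpace.generateFrom_le fun U hU => ?_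
    -- `V K` is the largest open set of sequences whose trace at bound `K` comes from `U`; countably
    -- many such traces recover `U`.
    let V : ℕ → Set (ℕ → Y) := fun K => ⋃₀ {V | IsOpen V ∧
      evalBasis b ⁻¹' (V ∩ boundedValues Y b K) ⊆ U}
    refine ⟨⋃ K : ℕ, V K ∩ boundedValues Y b K, MeasurableSet.iUnion fun K =>
      (isOpen_sUnion fun V hV => hV.1).measurableSet.inter
        (isClosed_boundedValues b K).measurableSet, ?_⟩
    ext T
    constructor
    · intro hT
      obtain ⟨K, ⟨V, ⟨hV1, hV2⟩, hV3⟩, hK⟩ := mem_iUnion.1 hT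
      exact hV2 ⟨hV3, hK⟩
    · intro hT
      have hr : evalBasis b T ∈ range (evalBasis (Y := Y) b) := ⟨T, rfl⟩
      rw [range_evalBasis, mem_iUnion] at hr
      obtain ⟨K, hK⟩ := hr
      have hU' := comap_evalBasis_inf_le_nhds b hK (IsOpen.mem_nhds hU hT)
      rw [mem_inf_principal, mem_comap] at hU'
      obtain ⟨V', hV', hsub⟩ := hU'
      obtain ⟨V'', hV1, hV2, hV3⟩ := mem_nhds_iff.1 hV'
      exact mem_iUnion.2 ⟨K, ⟨V'', ⟨hV2, fun S hS => hsub (hV1 hS.1) hS.2⟩, hV3⟩, hK⟩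
  obtain ⟨V, hV, rfl⟩ := hle s hs
  rw [image_preimage_eq_inter_range]
  exact hV.inter hrange

end OperatorSpace

/-- A Polish topology on the Borel range, pulled back along the embedding, generates the given
measurable structure. -/
theorem MeasurableEmbedding.standardBorelSpace {α β : Type*}
    [MeasurableSpace α] [MeasurableSpace β] [StandardBorelSpace β] {f : α → β}
    (hf : MeasurableEmbedding f) : StandardBorelSpace α := by
  have := hf.measurableSet_range.standardBorel
  let e := hf.equivRange
  let := upgradeStandardBorel (range f)
  refine ⟨⟨TopologicalSpace.induced e inferInstance, ?_, e.toEquiv.polishSpace_induced⟩⟩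
  refine @BorelSpace.mk _ (TopologicalSpace.induced e inferInstance) _ ?_
  exact e.measurableEmbedding.comap_eq.symm.trans ((congrArg (MeasurableSpace.comap e)
    (eq_borel_upgradeStandardBorel (range f))).trans borel_comap.symm)

theorem UnconditionalSchauderBasis.standardBorelSpace_operators {X Y : Type*}
    [NormedAddCommGroup X] [NormedSpace ℝ X] [NormedAddCommGroup Y] [NormedSpace ℝ Y]
    [CompleteSpace Y] [TopologicalSpace.SeparableSpace Y]
    (b : UnconditionalSchauderBasis ℕ ℝ X) : StandardBorelSpace (X →Lₚₜ[ℝ] Y) := by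
  borelize Y
  exact (measurableEmbedding_evalBasis (Y := Y) b).standardBorelSpace

/-! ### The set of strictly singular operators is co-analytic -/

section Coanalytic

variable {X Y : Type*} [NormedAddCommGroup X] [NormedSpace ℝ X] [NormedAddCommGroup Y]
  [NormedSpace ℝ Y]

/-- Failure of strict singularity, as the existence of a sequence satisfying countably many
inequalities. -/
theorem not_isStrictlySingular_iff (T : X →Lₚₜ[ℝ] Y) :
    ¬ IsStrictlySingular T ↔ ∃ x : ℕ → X, ∃ k : ℕ, (∀ n, ‖x n‖ ≤ k) ∧
      (∀ m n, m ≠ n → 1 ≤ ‖x m - x n‖) ∧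
      ∀ (N : ℕ) (q : Fin N → ℚ), ‖∑ i, (q i : ℝ) • x i‖ ≤ k * ‖T (∑ i, (q i : ℝ) • x i)‖ := by
  let T' : X →L[ℝ] Y := T
  constructor
  · intro h
    simp only [IsStrictlySingular] at h
    push Not at h
    obtain ⟨Z, hZ, c, hc, hcT⟩ := h
    obtain ⟨R, f, -, hR, hf⟩ := exists_seq_norm_le_one_le_norm_sub (𝕜 := ℝ) (E := Z) hZ
    obtain ⟨k, hk⟩ := exists_nat_ge (max R c⁻¹)
    refine ⟨fun n => f n, k, fun n => (hR n).trans ((le_max_left _ _).trans hk),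
      fun m n hmn => hf hmn, fun N q => ?_⟩
    have hmem : ∑ i : Fin N, (q i : ℝ) • (f i : X) ∈ Z :=
      Z.sum_mem fun i _ => Z.smul_mem _ (f i).2
    have h1 := hcT _ hmem
    have h2 : c⁻¹ ≤ k := (le_max_right _ _).trans hk
    rw [← le_inv_mul_iff₀ hc] at h1
    exact h1.trans (mul_le_mul_of_nonneg_right h2 (norm_nonneg _))
  -- A bounded separated sequence cannot lie in a finite-dimensional space, and the inequality
  -- passes from rational to real coefficients by density.
  · rintro ⟨x, k, hk, hsep, hT⟩ hS
    have hreal : ∀ (N : ℕ) (a : Fin N → ℝ), ‖∑ i, a i • x i‖ ≤ k * ‖T' (∑ i, a i • x i)‖ := by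
      intro N a
      have hc : IsClosed {a : Fin N → ℝ | ‖∑ i, a i • x i‖ ≤ k * ‖T' (∑ i, a i • x i)‖} :=
        isClosed_le (by fun_prop) (by fun_prop)
      have hd : DenseRange fun (q : Fin N → ℚ) (i : Fin N) => (q i : ℝ) :=
        DenseRange.piMap fun _ => Rat.denseRange_cast
      refine hd.induction_on (p := fun a => ‖∑ i, a i • x i‖ ≤ k * ‖T' (∑ i, a i • x i)‖) a hc
        fun q => hT N q
    refine hS (Submodule.span ℝ (range x)) (fun hfd => ?_) ⟨((k : ℝ) + 1)⁻¹, by positivity, ?_⟩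
    · let y : ℕ → Submodule.span ℝ (range x) := fun n => ⟨x n, Submodule.subset_span ⟨n, rfl⟩⟩
      have : ProperSpace (Submodule.span ℝ (range x)) := FiniteDimensional.proper ℝ _
      obtain ⟨l, -, φ, hφ, hl⟩ := (isCompact_closedBall (0 : Submodule.span ℝ (range x))
        (k : ℝ)).tendsto_subseq (x := y) fun n => by
          rw [mem_closedBall_zero_iff]; exact hk n
      obtain ⟨N, hN⟩ := (Metric.cauchySeq_iff.1 hl.cauchySeq) 1 one_pos
      have h1 := hN N le_rfl (N + 1) (Nat.le_succ N)
      rw [dist_eq_norm] at h1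
      exact absurd (hsep _ _ (hφ.injective.ne (Nat.succ_ne_self N).symm)) (not_le.2 h1)
    · intro z hz
      obtain ⟨a, rfl⟩ := (Finsupp.mem_span_range_iff_exists_finsupp).1 hz
      have e : (a.sum fun i r => r • x i) =
          ∑ i : Fin (a.support.sup id + 1), a i • x i := by
        rw [Fin.sum_univ_eq_sum_range (fun i => a i • x i), Finsupp.sum]
        refine Finset.sum_subset (fun i hi => ?_) fun i _ hi => ?_
        · exact Finset.mem_range.2 (Nat.lt_succ_of_le (Finset.le_sup (f := id) hi))
        · rw [Finsupp.notMem_support_iff.1 hi, zero_smul]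
      rw [e, inv_mul_le_iff₀ (by positivity)]
      refine (hreal _ fun i => a i).trans ?_
      exact mul_le_mul_of_nonneg_right (by linarith) (norm_nonneg _)

/-- Evaluation is a Carathéodory function: continuous in the vector, Borel in the operator. -/
theorem measurable_apply_operator [MeasurableSpace X] [BorelSpace X]
    [TopologicalSpace.SeparableSpace X] [MeasurableSpace Y] [BorelSpace Y] :
    Measurable fun z : (X →Lₚₜ[ℝ] Y) × X => z.1 z.2 := by
  have h := measurable_uncurry_of_continuous_of_measurable
    (u := fun (x : X) (T : X →Lₚₜ[ℝ] Y) => T x)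
    (fun T => (show X →L[ℝ] Y from T).continuous)
    (fun x => (PointwiseConvergenceCLM.continuousEvalConst.continuous_eval_const x).measurable)
  exact h.comp measurable_swap

/-- By `not_isStrictlySingular_iff` the complement is the projection of a Borel set of pairs of an
operator and a sequence. -/
theorem isCoanalytic_strictlySingularOperators [CompleteSpace X] [CompleteSpace Y]
    [TopologicalSpace.SeparableSpace X] [TopologicalSpace.SeparableSpace Y]
    [StandardBorelSpace (X →Lₚₜ[ℝ] Y)] : IsCoanalytic (strictlySingularOperators X Y) := by
  borelize X Y
  let S : ℕ → Set ((X →Lₚₜ[ℝ] Y) × (ℕ → X)) := fun k => {z | (∀ n, ‖z.2 n‖ ≤ k) ∧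
    (∀ m n, m ≠ n → 1 ≤ ‖z.2 m - z.2 n‖) ∧
    ∀ (N : ℕ) (q : Fin N → ℚ), ‖∑ i, (q i : ℝ) • z.2 i‖ ≤ k * ‖z.1 (∑ i, (q i : ℝ) • z.2 i)‖}
  have hcoord : ∀ n, Measurable fun z : (X →Lₚₜ[ℝ] Y) × (ℕ → X) => z.2 n := fun n =>
    (measurable_pi_apply n).comp measurable_snd
  have hS : ∀ k, MeasurableSet (S k) := by
    intro k
    have e : S k = (⋂ n, {z | ‖z.2 n‖ ≤ k}) ∩
        ((⋂ m, ⋂ n, ⋂ _ : m ≠ n, {z | 1 ≤ ‖z.2 m - z.2 n‖}) ∩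
        ⋂ (N : ℕ), ⋂ q : Fin N → ℚ, {z | ‖∑ i, (q i : ℝ) • z.2 i‖ ≤
          k * ‖z.1 (∑ i, (q i : ℝ) • z.2 i)‖}) := by
      ext z
      simp only [S, mem_inter_iff, mem_iInter, mem_ofPred_eq]
    rw [e]
    refine MeasurableSet.inter ?_ (MeasurableSet.inter ?_ ?_)
    · exact MeasurableSet.iInter fun n => measurableSet_le (hcoord n).norm measurable_const
    · exact MeasurableSet.iInter fun m => MeasurableSet.iInter fun n => MeasurableSet.iInter
        fun _ => measurableSet_le measurable_const ((hcoord m).sub (hcoord n)).norm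
    · refine MeasurableSet.iInter fun N => MeasurableSet.iInter fun q => ?_
      have hsum : Measurable fun z : (X →Lₚₜ[ℝ] Y) × (ℕ → X) =>
          ∑ i : Fin N, (q i : ℝ) • z.2 i :=
        Finset.measurable_fun_sum _ fun i _ => (hcoord i).const_smul _
      exact measurableSet_le hsum.norm
        ((measurable_apply_operator.comp (measurable_fst.prodMk hsum)).norm.const_mul _)
  have : (strictlySingularOperators X Y)ᶜ = Prod.fst '' ⋃ k, S k := by
    ext T
    rw [mem_compl_iff, strictlySingularOperators, mem_ofPred_eq, not_isStrictlySingular_iff]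
    constructor
    · rintro ⟨x, k, h⟩
      exact ⟨(T, x), mem_iUnion.2 ⟨k, h⟩, rfl⟩
    · rintro ⟨⟨T, x⟩, hz, rfl⟩
      obtain ⟨k, h⟩ := mem_iUnion.1 hz
      exact ⟨x, k, h⟩
  rw [IsCoanalytic, this]
  exact isAnalytic_image measurable_fst (MeasurableSet.iUnion hS)

end Coanalytic

/-! ### Operators associated with trees -/

section TreeOperator

variable (p : ℝ) [hp : Fact (1 ≤ p)]

theorem UnconditionalSchauderBasis.coord_apply_basis {X β : Type*} [DecidableEq β]
    [NormedAddCommGroup X] [NormedSpace ℝ X] (b : UnconditionalSchauderBasis β ℝ X) (i j : β) :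
    b.coord i (b j) = if i = j then 1 else 0 := by
  convert b.ortho i j using 1
  convert (Pi.single_apply j (1 : ℝ) i).symm
  rfl

/-- An enumeration of the tree. -/
def nodeEquiv : ℕ ≃ List ℕ := (Denumerable.eqv (List ℕ)).symm

-- The norm of `Y_p` is dominated by that of `ℓ_p`, so this diagonal assignment is a contraction on
-- finite combinations.
open Classical in
theorem exists_treeOperator (S : Set (List ℕ)) : ∃ T : EllP p →L[ℝ] YSpace p, ∀ n,
    T (unitVec p n) = if nodeEquiv n ∈ S then nodeVector p (2 * p) (nodeEquiv n) else 0 := by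
  have hp0 : 0 < p := by linarith [hp.out]
  let ζ : ℕ → List ℕ →₀ ℝ := fun n => if nodeEquiv n ∈ S then Finsupp.single (nodeEquiv n) 1 else 0
  have hζ : ∀ n, treeEmb p (2 * p) (ζ n) =
      if nodeEquiv n ∈ S then nodeVector p (2 * p) (nodeEquiv n) else 0 := by
    intro n
    simp only [ζ]
    split_ifs
    · exact treeEmb_single p (2 * p) _
    · exact map_zero _
  obtain ⟨T, hT, -⟩ := (unitBasis p).exists_operator (fun n => treeEmb p (2 * p) (ζ n)) 1
    fun a => by
      rw [one_mul, ← map_linearCombination_comp]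
      refine (norm_treeEmb_le _).trans ?_
      rw [one_div, Real.rpow_inv_le_iff_of_pos (massOn_nonneg _ (absPow_nonneg _)) (norm_nonneg _)
        hp0]
      refine le_trans ?_ (norm_unitComb_rpow p a).ge
      rw [absPow_linearCombination (fun i j hij t => ?_), map_sum]
      · refine Finset.sum_le_sum fun k _ => ?_
        rw [map_smul, smul_eq_mul]
        refine mul_le_of_le_one_right (by positivity) ?_
        refine (massOn_le_massOn (absPow_nonneg _) (T := ({nodeEquiv k} : Finset (List ℕ)))
          fun t ht _ => ?_).trans ?_
        · have := absPow_support_subset _ ht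
          by_contra hne
          simp only [Finset.coe_singleton, mem_singleton_iff] at hne
          simp only [ζ] at this
          split_ifs at this
          · exact hne (by simpa using Finsupp.support_single_subset this)
          · simp at this
        · rw [massOn_coe_finset, Finset.sum_singleton, absPow_apply]
          simp only [ζ]
          split_ifs
          · simp
          · simp [Real.zero_rpow hp0.ne']
      · by_contra! h
        simp only [ζ] at h
        obtain ⟨h1, h2⟩ := h
        split_ifs at h1 h2
        · rw [Finsupp.single_apply_ne_zero] at h1 h2
          exact hij (nodeEquiv.injective (h1.1.symm.trans h2.1))
        all_goals simp at h1 h2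
  exact ⟨T, fun n => (hT n).trans (hζ n)⟩

/-- The operator sending the unit vector of a node of `S` to the node vector, and the other unit
vectors to zero. -/
def treeOperator (S : Set (List ℕ)) : EllP p →Lₚₜ[ℝ] YSpace p :=
  (exists_treeOperator p S).choose

open Classical in
theorem treeOperator_unitVec (S : Set (List ℕ)) (n : ℕ) : treeOperator p S (unitVec p n) =
    if nodeEquiv n ∈ S then nodeVector p (2 * p) (nodeEquiv n) else 0 :=
  (exists_treeOperator p S).choose_spec n

open Classical in
theorem treeCoord_treeOperator (S : Set (List ℕ)) (t : List ℕ) (x : EllP p) :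
    treeCoord p (2 * p) t (treeOperator p S x) = if t ∈ S then x (nodeEquiv.symm t) else 0 := by
  let L : EllP p →L[ℝ] ℝ := if t ∈ S then (unitBasis p).coord (nodeEquiv.symm t) else 0
  have h : (treeCoord p (2 * p) t).comp (show EllP p →L[ℝ] YSpace p from treeOperator p S) = L := by
    refine (unitBasis p).ext_operator fun n => ?_
    change treeCoord p (2 * p) t (treeOperator p S (unitVec p n)) = L (unitBasis p n)
    have hc : treeCoord p (2 * p) t (nodeVector p (2 * p) (nodeEquiv n)) =
        if t = nodeEquiv n then 1 else 0 := by
      rw [← treeEmb_single, treeCoord_treeEmb, Finsupp.single_apply]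
      exact if_congr eq_comm rfl rfl
    have hL : (unitBasis p).coord (nodeEquiv.symm t) (unitBasis p n) =
        if t = nodeEquiv n then 1 else 0 := by
      exact ((unitBasis p).coord_apply_basis _ _).trans
        (if_congr (Equiv.symm_apply_eq _) rfl rfl)
    rw [treeOperator_unitVec]
    by_cases ht : t = nodeEquiv n
    · subst ht
      by_cases hS : nodeEquiv n ∈ S
      · simp only [L, if_pos hS, hc, hL]
      · simp only [L, if_neg hS, map_zero, zero_apply]
    · have h1 : treeCoord p (2 * p) t
          (if nodeEquiv n ∈ S then nodeVector p (2 * p) (nodeEquiv n) else 0) = 0 := by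
        split_ifs
        · rw [hc, if_neg ht]
        · exact map_zero _
      rw [h1]
      by_cases hS : t ∈ S
      · simp only [L, if_pos hS, hL, if_neg ht]
      · simp only [L, if_neg hS, zero_apply]
  have h2 := DFunLike.congr_fun h x
  refine h2.trans ?_
  by_cases hS : t ∈ S
  · simp only [L, if_pos hS, unitBasis_coord_apply]
  · simp only [L, if_neg hS, zero_apply]

/-- The operator of a tree is strictly singular if and only if the tree is well-founded. -/
theorem isStrictlySingular_treeOperator_iff {S : Set (List ℕ)}
    (hS : ∀ s t, s <+: t → t ∈ S → s ∈ S) :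
    IsStrictlySingular (treeOperator p S) ↔ ¬ ∃ σ : ℕ → ℕ, ∀ n, branchNode σ n ∈ S := by
  have hp0 : 0 < p := by linarith [hp.out]
  constructor
  -- The unit vectors indexed by the branch go to the node vectors of that branch, where the norm of
  -- `Y_p` dominates the `ℓ_p` norm.
  · rintro hT ⟨σ, hσ⟩
    have hinj : Function.Injective fun k => nodeEquiv.symm (branchNode σ k) :=
      nodeEquiv.symm.injective.comp (branchNode_injective σ)
    have hv : ∀ a : ℕ →₀ ℝ, Finsupp.linearCombination ℝ
        (fun k => unitVec p (nodeEquiv.symm (branchNode σ k))) a =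
        Finsupp.linearCombination ℝ (unitVec p) (a.embDomain ⟨_, hinj⟩) := fun a => by
      rw [Finsupp.linearCombination_embDomain]
      rfl
    have hnorm : ∀ a : ℕ →₀ ℝ, ‖Finsupp.linearCombination ℝ
        (fun k => unitVec p (nodeEquiv.symm (branchNode σ k))) a‖ =
        ‖Finsupp.linearCombination ℝ (unitVec p) a‖ := fun a => by
      rw [← Real.rpow_left_inj (norm_nonneg _) (norm_nonneg _) hp0.ne', hv, norm_unitComb_rpow,
        norm_unitComb_rpow, Finsupp.support_embDomain, Finset.sum_map]
      exact Finset.sum_congr rfl fun i _ =>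
        congrArg (fun r : ℝ => |r| ^ p) (Finsupp.embDomain_apply_self ⟨_, hinj⟩ a i)
    refine not_isStrictlySingular_of_lower_estimate p (treeOperator p S)
      (fun k => unitVec p (nodeEquiv.symm (branchNode σ k))) one_pos (C := 1)
      (fun a => by rw [hnorm, one_mul]) (fun a => ?_) hT
    rw [one_mul, ← Real.rpow_le_rpow_iff (norm_nonneg _) (norm_nonneg _) hp0, norm_unitComb_rpow]
    refine le_trans ?_ (sum_branch_treeCoord_le _ σ (a.support.sup id + 1))
    have e : ∀ i, treeCoord p (2 * p) (branchNode σ i) (treeOperator p S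
        (Finsupp.linearCombination ℝ
          (fun k => unitVec p (nodeEquiv.symm (branchNode σ k))) a)) = a i := fun i => by
      rw [treeCoord_treeOperator, if_pos (hσ i), hv, unitComb_apply]
      exact Finsupp.embDomain_apply_self ⟨_, hinj⟩ a i
    simp_rw [e]
    exact Finset.sum_le_sum_of_subset_of_nonneg (fun i hi => Finset.mem_range.2
      (Nat.lt_succ_of_le (Finset.le_sup (f := id) hi))) fun i _ _ => by positivity
  -- Every branch leaves the tree at some level `N` and never returns, so on it only finitely many
  -- coordinates of the images survive, each tending to zero.
  · intro hwf
    refine isStrictlySingular_of_branch _ fun u hu σ δ hδ => ?_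
    have hex : ∃ N, branchNode σ N ∉ S := by
      by_contra! h
      exact hwf ⟨σ, h⟩
    obtain ⟨N, hN⟩ := hex
    have hlim : Tendsto (fun k => ∑ i ∈ Finset.range N,
        |u k (nodeEquiv.symm (branchNode σ i))| ^ p) atTop (𝓝 0) := by
      have h0 : ∀ i, Tendsto (fun k => |u k (nodeEquiv.symm (branchNode σ i))| ^ p) atTop
          (𝓝 0) := fun i => by
        have := ((hu (nodeEquiv.symm (branchNode σ i))).abs).rpow_const (p := p) (Or.inr hp0.le)
        simpa [Real.zero_rpow hp0.ne'] using this
      simpa using tendsto_finsetSum (Finset.range N) fun i _ => h0 i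
    filter_upwards [hlim.eventually_le_const hδ] with k hk n
    refine le_trans ?_ hk
    have hout : ∀ i, N ≤ i → |treeCoord p (2 * p) (branchNode σ i) (treeOperator p S (u k))| ^ p
        = 0 := fun i hi => by
      rw [treeCoord_treeOperator, if_neg fun h => hN (hS _ _ (branchNode_prefix σ hi) h), abs_zero,
        Real.zero_rpow hp0.ne']
    calc ∑ i ∈ Finset.range n, |treeCoord p (2 * p) (branchNode σ i) (treeOperator p S (u k))| ^ p
        ≤ ∑ i ∈ Finset.range (max n N),
          |treeCoord p (2 * p) (branchNode σ i) (treeOperator p S (u k))| ^ p :=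
          Finset.sum_le_sum_of_subset_of_nonneg
            (Finset.range_subset_range.2 (le_max_left _ _)) fun i _ _ => by positivity
      _ = ∑ i ∈ Finset.range N,
          |treeCoord p (2 * p) (branchNode σ i) (treeOperator p S (u k))| ^ p := by
          symm
          refine Finset.sum_subset (Finset.range_subset_range.2 (le_max_right _ _))
            fun i _ hi => hout i ?_
          simpa using hi
      _ ≤ _ := by
          refine Finset.sum_le_sum fun i _ => ?_
          rw [treeCoord_treeOperator]
          split_ifs
          · exact le_rfl
          · rw [abs_zero, Real.zero_rpow hp0.ne']
            positivity

end TreeOperator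

/-! ### The complexity of the set of strictly singular operators -/

section Complexity

variable (p : ℝ) [hp : Fact (1 ≤ p)]

instance separableSpace_ellP : TopologicalSpace.SeparableSpace (EllP p) :=
  (unitBasis p).separableSpace

instance separableSpace_ySpace : TopologicalSpace.SeparableSpace (YSpace p) :=
  (nodeBasis p (2 * p)).separableSpace

instance standardBorelSpace_operators : StandardBorelSpace (EllP p →Lₚₜ[ℝ] YSpace p) :=
  (unitBasis p).standardBorelSpace_operators

/-- An operator-valued map is Borel once its values on the basis are, and each of these depends on a
single node. -/
theorem measurable_treeOperator {W : Type*} [MeasurableSpace W] {𝒯 : W → Set (List ℕ)}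
    (h𝒯 : ∀ t, MeasurableSet {w | t ∈ 𝒯 w}) : Measurable fun w => treeOperator p (𝒯 w) := by
  classical
  borelize (YSpace p)
  rw [← (measurableEmbedding_evalBasis (Y := YSpace p) (unitBasis p)).measurable_comp_iff]
  refine measurable_pi_iff.2 fun n => ?_
  have e : (fun w => (evalBasis (unitBasis p) ∘ fun w => treeOperator p (𝒯 w)) w n) =
      fun w => if nodeEquiv n ∈ 𝒯 w then nodeVector p (2 * p) (nodeEquiv n) else 0 := by
    funext w
    exact (treeOperator_unitVec p (𝒯 w) n).trans (by congr)
  rw [e]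
  exact Measurable.ite (h𝒯 _) measurable_const measurable_const

/-- Every co-analytic set is a Borel preimage of the set of strictly singular operators. -/
theorem exists_measurable_preimage_strictlySingularOperators {W : Type*} [MeasurableSpace W]
    [StandardBorelSpace W] {C : Set W} (hC : IsCoanalytic C) :
    ∃ f : W → (EllP p →Lₚₜ[ℝ] YSpace p), Measurable f ∧
      f ⁻¹' strictlySingularOperators (EllP p) (YSpace p) = C := by
  obtain ⟨𝒯, h1, h2, h3⟩ := IsAnalytic.exists_tree (A := Cᶜ) hC
  refine ⟨fun w => treeOperator p (𝒯 w), measurable_treeOperator p h1, ?_⟩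
  ext w
  refine (isStrictlySingular_treeOperator_iff p (h2 w)).trans ?_
  rw [← h3, mem_compl_iff, not_not]

theorem not_measurableSet_strictlySingularOperators :
    ¬ MeasurableSet (strictlySingularOperators (EllP p) (YSpace p)) := by
  intro h
  obtain ⟨A, hA, hA'⟩ := exists_isAnalytic_not_measurableSet
  obtain ⟨f, hf, he⟩ := exists_measurable_preimage_strictlySingularOperators p
    (C := Aᶜ) (by rwa [IsCoanalytic, compl_compl])
  have h' := hf h
  rw [he] at h'
  exact hA' h'.of_compl

end Complexity

/-! ### Bounded ranks and the main theorem -/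

/-- A map attaining its maximum is not a co-analytic rank on a co-analytic set that is not Borel. -/
theorem IsCoanalytic.not_isCoanalyticRank {E : Type*} [MeasurableSpace E] [StandardBorelSpace E]
    {B : Set E} (hB : IsCoanalytic B) (hB' : ¬ MeasurableSet B) {φ : B → Ordinal.{0}} {y : B}
    (hy : ∀ x, φ x ≤ φ y) : ¬ IsCoanalyticRank B φ := by
  rintro ⟨-, R₁, R₂, h1, -, h⟩
  -- At a point `y` of maximal value the section of `R₁` is the whole of `B`, which is therefore
  -- analytic too.
  refine hB' (measurableSet_of_isAnalytic_compl ?_ hB)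
  convert h1.section_right (y : E) using 1
  ext x
  exact ⟨fun hx => (h y x).1.1 ⟨hx, hy _⟩, fun hx => ((h y x).1.2 hx).1⟩

/-- A map into the ordinals with finitely many possible values attains its maximum. -/
theorem exists_forall_le_of_le_two {α : Type*} [Nonempty α] {φ : α → Ordinal.{0}}
    (h : ∀ x, φ x ≤ 2) : ∃ y, ∀ x, φ x ≤ φ y := by
  have hfin : (range φ).Finite := by
    refine ((Set.finite_Iic 2).image fun n : ℕ => (n : Ordinal.{0})).subset ?_
    rintro _ ⟨x, rfl⟩
    have hlt : φ x < ω := (h x).trans_lt (by exact_mod_cast Ordinal.natCast_lt_omega0 2)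
    obtain ⟨n, hn⟩ := Ordinal.lt_omega0.1 hlt
    refine ⟨n, ?_, hn.symm⟩
    have := h x
    rw [hn] at this
    exact_mod_cast this
  obtain ⟨_, ⟨y, rfl⟩, hy⟩ := hfin.exists_maximal (range_nonempty φ)
  refine ⟨y, fun x => ?_⟩
  rcases le_total (φ x) (φ y) with h' | h'
  · exact h'
  · exact hy ⟨x, rfl⟩ h'

end

theorem theorem1p4 (p : ℝ) [Fact (1 ≤ p)] :
    -- every enumeration of the node vectors is an unconditional basis of `Y_p`
    (∀ e : ℕ ≃ List ℕ, ∃ b : UnconditionalSchauderBasis ℕ ℝ (YSpace p),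
      ∀ n, b n = nodeVector p (2 * p) (e n)) ∧
    -- the strictly singular operators form a complete co-analytic, non-Borel set
    IsCompleteCoanalytic.{0, u} (strictlySingularOperators (EllP p) (YSpace p)) ∧
    ¬ MeasurableSet (strictlySingularOperators (EllP p) (YSpace p)) ∧
    -- the rank is at most two on it, and it is not a co-analytic rank
    ∀ c : LimitSequences,
      (∀ T ∈ strictlySingularOperators (EllP p) (YSpace p), rho c T ≤ 2) ∧
      ¬ IsCoanalyticRank (strictlySingularOperators (EllP p) (YSpace p))
        (fun T => rho c (T : EllP p →Lₚₜ[ℝ] YSpace p)) := by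
  have hco : IsCoanalytic (strictlySingularOperators (EllP p) (YSpace p)) :=
    isCoanalytic_strictlySingularOperators
  have hne := not_measurableSet_strictlySingularOperators p
  refine ⟨fun e => ⟨(nodeBasis p (2 * p)).reindex e, fun n => rfl⟩,
    ⟨inferInstance, hco, fun W _ _ C hC =>
      exists_measurable_preimage_strictlySingularOperators p hC⟩, hne, fun c =>
    ⟨fun T hT => rho_le_two c hT, ?_⟩⟩
  have : Nonempty (strictlySingularOperators (EllP p) (YSpace p)) := by
    rw [Set.nonempty_coe_sort, Set.nonempty_iff_ne_empty]
    intro h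
    exact hne (h ▸ MeasurableSet.empty)
  obtain ⟨y, hy⟩ := exists_forall_le_of_le_two
    (φ := fun T : strictlySingularOperators (EllP p) (YSpace p) =>
      rho c (T : EllP p →Lₚₜ[ℝ] YSpace p))
    fun T => rho_le_two c T.2
  exact hco.not_isCoanalyticRank hne hy
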